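/- **Setting.** Let $d\ge 1$, $L>0$, let $N\ge 2$ be an even integer, $\mathbf j_*\in\mathbb Z^d\setminus\{\mathbf 0\}$ and $\phi_{\mathbf j_*}=\phi_{-\mathbf j_*}>0$. For $\mathbf j\in\mathbb Z^d$ put $k_{\mathbf j}=\frac{2\pi}{L}\mathbf j$, and put $\Delta_0=\min\{k_{\mathbf j}^2:\mathbf j\ne\mathbf 0\}$, $\epsilon=k_{\mathbf j_*}^2/\phi_{\mathbf j_*}$, $$E^{Bog}_{\mathbf j_*}=-\Big[k^2_{\mathbf j_*}+\phi_{\mathbf j_*}-\sqrt{(k^2_{\mathbf j_*})^2+2\phi_{\mathbf j_*}k^2_{\mathbf j_*}}\Big],\qquad z_{\max}=E^{Bog}_{\mathbf j_*}+\sqrt{\epsilon}\,\phi_{\mathbf j_*}\sqrt{\epsilon^2+2\epsilon}.$$ On the $N$-particle sector $\mathcal F^N$ of the bosonic Fock space over $L^2$ of the torus of side $L$, with $a_{\mathbf j},a^*_{\mathbf j}$ the annihilation and creation operators of the mode $k_{\mathbf j}$, let $W=\phi_{\mathbf j_*}\frac{a_{\mathbf 0}^*a_{\mathbf 0}^*a_{\mathbf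 j_*}a_{-\mathbf j_*}}{N}$, let $W^*=\phi_{\mathbf j_*}\frac{a_{\mathbf 0}a_{\mathbf 0}a^*_{\mathbf j_*}a^*_{-\mathbf j_*}}{N}$ and $$H=\sum_{\mathbf j\ne\pm\mathbf j_*}k_{\mathbf j}^2a^*_{\mathbf j}a_{\mathbf j}+\sum_{\mathbf j=\pm\mathbf j_*}\Big(k_{\mathbf j}^2+\phi_{\mathbf j_*}\frac{a_{\mathbf 0}^*a_{\mathbf 0}}{N}\Big)a^*_{\mathbf j}a_{\mathbf j}+W+W^* .$$ For even $i$, $0\le i\le N-2$, let $Q^{(i,i+1)}$ and $Q^{(>i+1)}$ be the orthogonal projections of $\mathcal F^N$ onto the vectors with, respectively, $N-i$ or $N-i-1$, and fewer than $N-i-1$, particles in the modes $\pm\mathbf j_*$. Let $\eta$ be the normalized state with all $N$ particles in the mode $\mathbf 0$, $\mathscr P_\eta=|\eta\rangle\langle\eta|$ and $\overline{\mathscr P_\eta}=Q^{(>N-1)}-\mathscr P_\eta$. For projections $P,\overline P$ and an operator $K$ the Feshbach–Schur map is $\mathscr F_{P,\overline P}(K)=PKP-PK\overline P\,(\overline PK\overline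 P)^{-1}\overline PKP$, the inverse being taken on the range of $\overline P$. For real $z$ put $\mathscr K^{(-2)}(z)=H-z$, $\mathscr K^{(i)}(z)=\mathscr F_{Q^{(>i+1)},\,Q^{(i,i+1)}}(\mathscr K^{(i-2)}(z))$ for $i=0,2,\dots,N-2$, and $\mathscr K^{(N)}(z)=\mathscr F_{\mathscr P_\eta,\overline{\mathscr P_\eta}}(\mathscr K^{(N-2)}(z))$. Let $$R_i(z)=Q^{(i,i+1)}\big(Q^{(i,i+1)}(H-z)Q^{(i,i+1)}\big)^{-1}Q^{(i,i+1)},\qquad \Gamma_0(z)=0,$$ $$\Gamma_{i}(z)=Q^{(i,i+1)}W\,R_{i-2}(z)\sum_{l\ge 0}\big[\Gamma_{i-2}(z)R_{i-2}(z)\big]^{l}\,W^*Q^{(i,i+1)}\quad (i=2,4,\dots,N-2),$$ $$f(z)=-z-\Big\langle\eta,\;W\,R_{N-2}(z)\sum_{l\ge0}\big[\Gamma_{N-2}(z)R_{N-2}(z)\big]^{l}\,W^*\eta\Big\rangle .$$ **Lemma.** For every $0<\gamma<1$ there is $k_\gamma>0$ such that for all $0<\mu<1$, $\theta>0$ and $C>0$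 there is $\epsilon_0>0$ (depending only on $\gamma,\mu,\theta,C$) for which the following holds for all $d,L,N,\mathbf j_*,\phi_{\mathbf j_*}$ as above with $\epsilon\le\epsilon_0$. Assume $$\epsilon^2+\frac{\epsilon}{N^\gamma}+\frac1N\le k_\gamma\,\epsilon\sqrt\epsilon,\qquad \frac1{N^{1-\gamma}}\le k_\gamma\,\epsilon,$$ $$\frac{\phi_{\mathbf j_*}}{\Delta_0}\,\frac{N^\mu}{N(N-N^\mu)}<\frac12,\qquad \frac1{N^\mu}\le C\,(\sqrt\epsilon)^{1+\theta}.$$ Then: 1. For every $z\le z_{\max}$ all inverses occurring in $\mathscr K^{(i)}(z)$, $i=0,2,\dots,N-2$, exist as bounded operators, and so do the resolvents $R_i(z)$; the Neumann series $\sum_l[\Gamma_i(z)R_i(z)]^l$, $i=0,2,\dots,N-2$, are summable in operator norm. In particular $\mathscr K^{(N-2)}(z)$ and $f(z)$ are well defined. 2. There is exactly one $z_*\le z_{\max}$ with $f(z_*)=0$, and it satisfies $z_*<\min\{z_*+\frac{\Delta_0}2,\;z_{\max}\}$. 3. For every $z<\min\{z_*+\frac{\Delta_0}2,\;z_{\max}\}$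 the operator $\overline{\mathscr P_\eta}\,\mathscr K^{(N-2)}(z)\,\overline{\mathscr P_\eta}$ is bounded invertible on $\overline{\mathscr P_\eta}\mathcal F^N$; hence $\mathscr K^{(N)}(z)$ is well defined, and $\mathscr K^{(N)}(z)=f(z)\,|\eta\rangle\langle\eta|$. -/

import Mathlib

open scoped InnerProductSpace

noncomputable section

namespace BogThreeModes

/-! ### Modes, occupation numbers, the `N`-particle space -/

/-- Labels `j ∈ ℤ^d` of the momentum modes `(2π/L) j`. -/
abbrev Mode (d : ℕ) := Fin d → ℤ

/-- Occupation numbers: finitely many particles distributed over the modes. -/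
abbrev Occ (d : ℕ) := Mode d →₀ ℕ

/-- Occupation numbers of exactly `N` particles. -/
abbrev Config (d N : ℕ) := {n : Occ d // (n.sum fun _ m => m) = N}

/-- The `N`-particle sector of the bosonic Fock space over `L²` of the torus, in the occupation
number representation: `ψ c` is the coefficient of `ψ` along the normalized product state with
occupation numbers `c`. -/
abbrev FockN (d N : ℕ) := lp (fun _ : Config d N => ℂ) 2

/-- Linear operators on arbitrary (not necessarily square summable) coefficient families. -/
abbrev FormalOp (d : ℕ) := Module.End ℂ (Occ d → ℂ)

/-- The annihilation operator `a_j`. -/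
def annih {d : ℕ} (j : Mode d) : FormalOp d where
  toFun ψ n := (Real.sqrt (n j + 1) : ℂ) * ψ (n + Finsupp.single j 1)
  map_add' ψ χ := by ext n; simp [mul_add]
  map_smul' r ψ := by ext n; simp [mul_left_comm]

/-- The creation operator `a_j^*`. If `n j = 0` the prefactor vanishes. -/
def creat {d : ℕ} (j : Mode d) : FormalOp d where
  toFun ψ n := (Real.sqrt (n j) : ℂ) * ψ (n - Finsupp.single j 1)
  map_add' ψ χ := by ext n; simp [mul_add]
  map_smul' r ψ := by ext n; simp [mul_left_comm]

/-- `k_j² = |(2π/L) j|²`. -/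
def kSq {d : ℕ} (L : ℝ) (j : Mode d) : ℝ := ∑ i, (2 * Real.pi / L * (j i : ℝ)) ^ 2

/-- `Δ₀ = min {k_j² : j ≠ 0}`. -/
def gap (d : ℕ) (L : ℝ) : ℝ := ⨅ j : {j : Mode d // j ≠ 0}, kSq L j.1

/-- `∑_{j ≠ ± j⋆} k_j² a_j^* a_j`. On the coefficient at `n` only the modes occupied in `n`
contribute. -/
def kineticRest {d : ℕ} (L : ℝ) (js : Mode d) : FormalOp d where
  toFun ψ n := ∑ j ∈ n.support with j ≠ js ∧ j ≠ -js, (kSq L j : ℂ) * (creat j * annih j) ψ n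
  map_add' ψ χ := by ext n; simp [mul_add, Finset.sum_add_distrib]
  map_smul' r ψ := by ext n; simp [Finset.mul_sum, mul_left_comm]

/-- `Ĥ⁰_j = (k_j² + φ a₀^* a₀ / N) a_j^* a_j + (k_j² + φ a₀^* a₀ / N) a_{-j}^* a_{-j}`. -/
def hZero {d : ℕ} (N : ℕ) (L φ : ℝ) (j : Mode d) : FormalOp d :=
  ((kSq L j : ℂ) • (1 : FormalOp d) + ((φ / N : ℝ) : ℂ) • (creat 0 * annih 0))
      * (creat j * annih j)
    + ((kSq L j : ℂ) • (1 : FormalOp d) + ((φ / N : ℝ) : ℂ) • (creat 0 * annih 0))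
      * (creat (-j) * annih (-j))

/-- `W_j = φ a₀^* a₀^* a_j a_{-j} / N`. -/
def wFormal {d : ℕ} (N : ℕ) (φ : ℝ) (j : Mode d) : FormalOp d :=
  ((φ / N : ℝ) : ℂ) • (creat 0 * creat 0 * annih j * annih (-j))

/-- `W_j^* = φ a₀ a₀ a_j^* a_{-j}^* / N`. -/
def wStarFormal {d : ℕ} (N : ℕ) (φ : ℝ) (j : Mode d) : FormalOp d :=
  ((φ / N : ℝ) : ℂ) • (annih 0 * annih 0 * creat j * creat (-j))

/-- The three-modes Bogoliubov Hamiltonian as a formal operator. -/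
def hBogFormal {d : ℕ} (N : ℕ) (L φ : ℝ) (js : Mode d) : FormalOp d :=
  kineticRest L js + (hZero N L φ js + wFormal N φ js + wStarFormal N φ js)

/-- Number of particles in the modes `± j⋆`. -/
def pairNum {d : ℕ} (js : Mode d) (n : Occ d) : ℕ := n js + n (-js)

/-- Restriction of coefficients to the occupation numbers in `S`. -/
def cutFormal {d : ℕ} (S : Set (Occ d)) : FormalOp d where
  toFun ψ n := S.indicator 1 n * ψ n
  map_add' ψ χ := by ext n; simp [mul_add]
  map_smul' r ψ := by ext n; simp [mul_left_comm]

/-! ### Realization of formal operators on the `N`-particle space -/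

/-- An `N`-particle coefficient family as a family on all occupation numbers. -/
def extend {d N : ℕ} : (Config d N → ℂ) →ₗ[ℂ] (Occ d → ℂ) where
  toFun ψ n := if h : (n.sum fun _ m => m) = N then ψ ⟨n, h⟩ else 0
  map_add' ψ χ := by ext n; by_cases h : (n.sum fun _ m => m) = N <;> simp [h]
  map_smul' r ψ := by ext n; by_cases h : (n.sum fun _ m => m) = N <;> simp [h]

/-- The action of a (number preserving) formal operator on `N`-particle coefficients. -/
def act {d N : ℕ} (A : FormalOp d) (ψ : FockN d N) (c : Config d N) : ℂ :=
  A (extend (fun c' => ψ c')) c.1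

/-- The operator on the `N`-particle space given by `A`, on its maximal domain
`{ψ : A ψ is square summable}`. -/
def realize {d : ℕ} (N : ℕ) (A : FormalOp d) : FockN d N →ₗ.[ℂ] FockN d N where
  domain :=
    { carrier := {ψ | Memℓp (act A ψ) 2}
      add_mem' := by
        intro ψ χ hψ hχ
        have h : act A (ψ + χ) = act A ψ + act A χ := by
          ext c
          simp only [act, Pi.add_apply]
          rw [← Pi.add_apply (A _), ← map_add, ← map_add]
          rfl
        show Memℓp _ 2
        rw [h]
        exact Memℓp.add hψ hχ
      zero_mem' := by
        have h : act A (0 : FockN d N) = 0 := by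
          ext c
          have : (fun c' => (0 : FockN d N) c') = (0 : Config d N → ℂ) := rfl
          simp only [act]
          rw [this, map_zero, map_zero]
          rfl
        show Memℓp _ 2
        rw [h]
        exact zero_memℓp
      smul_mem' := by
        intro r ψ hψ
        have h : act A (r • ψ) = r • act A ψ := by
          ext c
          simp only [act, Pi.smul_apply]
          rw [← Pi.smul_apply r (A _), ← map_smul, ← map_smul]
          rfl
        show Memℓp _ 2
        rw [h]
        exact Memℓp.const_smul hψ r }
  toFun :=
    { toFun := fun ψ => ⟨act A ψ.1, ψ.2⟩
      map_add' := by
        intro ψ χ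
        ext c
        simp only [act, lp.coeFn_add, Pi.add_apply, Submodule.coe_add]
        rw [← Pi.add_apply (A _), ← map_add, ← map_add]
        rfl
      map_smul' := by
        intro r ψ
        ext c
        simp only [act, lp.coeFn_smul, Pi.smul_apply, Submodule.coe_smul, RingHom.id_apply]
        rw [← Pi.smul_apply r (A _), ← map_smul, ← map_smul]
        rfl }

/-- The bounded operator on the `N`-particle space given by `A` (it exists for all the formal
operators it is applied to, see `boundedOp_cut`, `boundedOp_w` and `boundedOp_wStar`). -/
def boundedOp {d : ℕ} (N : ℕ) (A : FormalOp d) : FockN d N →L[ℂ] FockN d N := by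
  classical
  exact if h : ∃ B : FockN d N →L[ℂ] FockN d N, ∀ ψ c, B ψ c = act A ψ c then h.choose else 0

theorem sum_extend_le {d N : ℕ} (ψ : FockN d N) (T : Finset (Occ d)) :
    ∑ n ∈ T, ‖extend (fun c' => ψ c') n‖ ^ 2 ≤ ‖ψ‖ ^ 2 := by
  classical
  have h1 : ∑ n ∈ T, ‖extend (fun c' => ψ c') n‖ ^ 2
      = ∑ n ∈ T with (n.sum fun _ m => m) = N, ‖extend (fun c' => ψ c') n‖ ^ 2 := by
    rw [Finset.sum_filter]
    refine Finset.sum_congr rfl fun n _ => ?_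
    split_ifs with h
    · rfl
    · simp [extend, h]
  rw [h1, ← Finset.sum_subtype_eq_sum_filter]
  have h2 := lp.sum_rpow_le_norm_rpow (p := 2) (by simp) ψ
    (T.subtype fun n => (n.sum fun _ m => m) = N)
  simp only [ENNReal.toReal_ofNat, Real.rpow_ofNat] at h2
  refine le_trans (le_of_eq ?_) h2
  refine Finset.sum_congr rfl fun c _ => ?_
  simp [extend, c.2]

theorem exists_bounded {d N : ℕ} (A : FormalOp d) (w : Occ d → ℂ) (σ : Occ d → Occ d) (C : ℝ)
    (hA : ∀ ψ n, A ψ n = w n * ψ (σ n)) (hC : ∀ c : Config d N, ‖w c.1‖ ≤ C)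
    (hσ : Set.InjOn σ {n | w n ≠ 0}) :
    ∃ B : FockN d N →L[ℂ] FockN d N, ∀ ψ c, B ψ c = act A ψ c := by
  classical
  have key : ∀ (ψ : FockN d N) (s : Finset (Config d N)),
      ∑ c ∈ s, ‖act A ψ c‖ ^ 2 ≤ C ^ 2 * ‖ψ‖ ^ 2 := by
    intro ψ s
    have hinj : Set.InjOn (fun c : Config d N => σ c.1) (s.filter fun c => w c.1 ≠ 0) := by
      intro a ha b hb hab
      simp only [Finset.coe_filter, Set.mem_ofPred_eq] at ha hb
      exact Subtype.ext (hσ ha.2 hb.2 hab)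
    calc ∑ c ∈ s, ‖act A ψ c‖ ^ 2
        = ∑ c ∈ s with w c.1 ≠ 0, ‖act A ψ c‖ ^ 2 := by
          rw [Finset.sum_filter]
          refine Finset.sum_congr rfl fun c _ => ?_
          split_ifs with h
          · rfl
          · have h0 : w c.1 = 0 := not_not.mp h
            simp [act, hA, h0]
      _ ≤ ∑ c ∈ s with w c.1 ≠ 0, C ^ 2 * ‖extend (fun c' => ψ c') (σ c.1)‖ ^ 2 := by
          refine Finset.sum_le_sum fun c _ => ?_
          simp only [act, hA, norm_mul, mul_pow]
          gcongr
          exact hC c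
      _ = C ^ 2 * ∑ n ∈ (s.filter fun c => w c.1 ≠ 0).image (fun c => σ c.1),
            ‖extend (fun c' => ψ c') n‖ ^ 2 := by
          rw [Finset.sum_image hinj, Finset.mul_sum]
      _ ≤ C ^ 2 * ‖ψ‖ ^ 2 := by
          gcongr
          exact sum_extend_le ψ _
  have hmem : ∀ ψ : FockN d N, Memℓp (act A ψ) 2 := fun ψ =>
    memℓp_gen' (C := C ^ 2 * ‖ψ‖ ^ 2) fun s => by simpa using key ψ s
  let T : FockN d N →ₗ[ℂ] FockN d N :=
    { toFun := fun ψ => (realize N A).toFun ⟨ψ, hmem ψ⟩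
      map_add' := fun ψ χ => (realize N A).toFun.map_add ⟨ψ, hmem ψ⟩ ⟨χ, hmem χ⟩
      map_smul' := fun r ψ => (realize N A).toFun.map_smul r ⟨ψ, hmem ψ⟩ }
  refine ⟨T.mkContinuous |C| fun ψ => ?_, fun ψ c => rfl⟩
  refine lp.norm_le_of_forall_sum_le (by simp) (by positivity) fun s => ?_
  have h := key ψ s
  rw [← sq_abs C, ← mul_pow] at h
  simp only [ENNReal.toReal_ofNat, Real.rpow_ofNat]
  exact h

theorem boundedOp_spec {d N : ℕ} {A : FormalOp d}
    (h : ∃ B : FockN d N →L[ℂ] FockN d N, ∀ ψ c, B ψ c = act A ψ c) (ψ : FockN d N)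
    (c : Config d N) : boundedOp N A ψ c = act A ψ c := by
  unfold boundedOp
  rw [dif_pos h]
  exact h.choose_spec ψ c

theorem boundedOp_cut {d N : ℕ} (S : Set (Occ d)) (ψ : FockN d N) (c : Config d N) :
    boundedOp N (cutFormal S) ψ c = act (cutFormal S) ψ c := by
  refine boundedOp_spec (exists_bounded _ (S.indicator 1) id 1 (fun _ _ => rfl) ?_ ?_) ψ c
  · intro c
    by_cases h : c.1 ∈ S <;> simp [h]
  · exact Function.injective_id.injOn

theorem le_of_config {d N : ℕ} (c : Config d N) (j : Mode d) : c.1 j ≤ N := by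
  have h := c.2
  by_cases hj : j ∈ c.1.support
  · calc c.1 j ≤ ∑ i ∈ c.1.support, c.1 i :=
        Finset.single_le_sum (f := fun i => c.1 i) (fun _ _ => Nat.zero_le _) hj
      _ = N := h
  · simp [Finsupp.notMem_support_iff.mp hj]

theorem boundedOp_w {d N : ℕ} (φ : ℝ) (j : Mode d) (ψ : FockN d N) (c : Config d N) :
    boundedOp N (wFormal N φ j) ψ c = act (wFormal N φ j) ψ c := by
  have hle : ∀ (c : Config d N) (k : Mode d) (n : Occ d), n ≤ c.1 → n k ≤ N := fun c k n h =>
    (h k).trans (le_of_config c k)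
  let e : Mode d → Occ d := fun k => Finsupp.single k 1
  refine boundedOp_spec (exists_bounded _
    (fun n => ((φ / N : ℝ) : ℂ) * ((Real.sqrt (n 0) : ℂ) * ((Real.sqrt ((n - e 0) 0) : ℂ) *
      ((Real.sqrt ((n - e 0 - e 0) j + 1) : ℂ) *
        (Real.sqrt ((n - e 0 - e 0 + e j) (-j) + 1) : ℂ)))))
    (fun n => n - e 0 - e 0 + e j + e (-j))
    (|φ / N| * (Real.sqrt (N + 2) * (Real.sqrt (N + 2) * (Real.sqrt (N + 2) *
      Real.sqrt (N + 2))))) ?_ ?_ ?_) ψ c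
  · intro ψ n
    simp only [wFormal, creat, annih, LinearMap.smul_apply, Module.End.mul_apply,
      LinearMap.coe_mk, AddHom.coe_mk, Pi.smul_apply, smul_eq_mul, e]
    ring
  · intro c
    have h0 : c.1 0 ≤ N := le_of_config c 0
    have h1 : (c.1 - e 0) 0 ≤ N := hle c _ _ tsub_le_self
    have h2 : (c.1 - e 0 - e 0) j ≤ N := hle c _ _ (tsub_le_self.trans tsub_le_self)
    have h3 : (c.1 - e 0 - e 0) (-j) ≤ N := hle c _ _ (tsub_le_self.trans tsub_le_self)
    have h4 : (c.1 - e 0 - e 0 + e j) (-j) ≤ N + 1 := by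
      have : e j (-j) ≤ 1 := by
        simp only [e, Finsupp.single_apply]; split_ifs <;> simp
      rw [Finsupp.add_apply]; omega
    have h0' : ((c.1 0 : ℕ) : ℝ) ≤ N := by exact_mod_cast h0
    have h1' : (((c.1 - e 0) 0 : ℕ) : ℝ) ≤ N := by exact_mod_cast h1
    have h2' : (((c.1 - e 0 - e 0) j : ℕ) : ℝ) ≤ N := by exact_mod_cast h2
    have h4' : (((c.1 - e 0 - e 0 + e j) (-j) : ℕ) : ℝ) ≤ N + 1 := by exact_mod_cast h4
    simp only [norm_mul, Complex.norm_real, Real.norm_eq_abs, abs_of_nonneg (Real.sqrt_nonneg _)]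
    have g0 := Real.sqrt_le_sqrt (show ((c.1 0 : ℕ) : ℝ) ≤ N + 2 by linarith)
    have g1 := Real.sqrt_le_sqrt (show (((c.1 - e 0) 0 : ℕ) : ℝ) ≤ N + 2 by linarith)
    have g2 := Real.sqrt_le_sqrt (show (((c.1 - e 0 - e 0) j : ℕ) : ℝ) + 1 ≤ N + 2 by linarith)
    have g4 := Real.sqrt_le_sqrt
      (show (((c.1 - e 0 - e 0 + e j) (-j) : ℕ) : ℝ) + 1 ≤ N + 2 by linarith)
    exact mul_le_mul_of_nonneg_left (mul_le_mul g0 (mul_le_mul g1 (mul_le_mul g2 g4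
      (by positivity) (by positivity)) (by positivity) (by positivity)) (by positivity)
      (by positivity)) (abs_nonneg _)
  · intro a ha b hb hab
    have two : ∀ n : Occ d, (((φ / N : ℝ) : ℂ) * ((Real.sqrt (n 0) : ℂ) *
        ((Real.sqrt ((n - e 0) 0) : ℂ) * ((Real.sqrt ((n - e 0 - e 0) j + 1) : ℂ) *
        (Real.sqrt ((n - e 0 - e 0 + e j) (-j) + 1) : ℂ))))) ≠ 0 → e 0 + e 0 ≤ n := by
      intro n hn
      have h : (n - e 0) 0 ≠ 0 := by
        intro h; simp [h] at hn
      intro k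
      by_cases hk : k = 0
      · subst hk
        simp [e] at h ⊢
        omega
      · simp [e, Ne.symm hk]
    have h := add_right_cancel (add_right_cancel hab)
    rw [tsub_tsub, tsub_tsub] at h
    rw [← tsub_add_cancel_of_le (two a ha), h, tsub_add_cancel_of_le (two b hb)]

theorem boundedOp_wStar {d N : ℕ} (φ : ℝ) (j : Mode d) (ψ : FockN d N) (c : Config d N) :
    boundedOp N (wStarFormal N φ j) ψ c = act (wStarFormal N φ j) ψ c := by
  let e : Mode d → Occ d := fun k => Finsupp.single k 1
  refine boundedOp_spec (exists_bounded _
    (fun n => ((φ / N : ℝ) : ℂ) * ((Real.sqrt (n 0 + 1) : ℂ) *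
      ((Real.sqrt ((n + e 0) 0 + 1) : ℂ) * ((Real.sqrt ((n + e 0 + e 0) j) : ℂ) *
        (Real.sqrt ((n + e 0 + e 0 - e j) (-j)) : ℂ)))))
    (fun n => n + e 0 + e 0 - e j - e (-j))
    (|φ / N| * (Real.sqrt (N + 2) * (Real.sqrt (N + 2) * (Real.sqrt (N + 2) *
      Real.sqrt (N + 2))))) ?_ ?_ ?_) ψ c
  · intro ψ n
    simp only [wStarFormal, creat, annih, LinearMap.smul_apply, Module.End.mul_apply,
      LinearMap.coe_mk, AddHom.coe_mk, Pi.smul_apply, smul_eq_mul, e]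
    ring
  · intro c
    have he : ∀ k, e 0 k ≤ 1 := by
      intro k
      simp only [e, Finsupp.single_apply]; split_ifs <;> simp
    have h0 : c.1 0 ≤ N := le_of_config c 0
    have h1 : (c.1 + e 0) 0 ≤ N + 1 := by
      have := he 0
      rw [Finsupp.add_apply]; omega
    have h2 : ∀ k, (c.1 + e 0 + e 0) k ≤ N + 2 := by
      intro k
      have := he k
      have := le_of_config c k
      rw [Finsupp.add_apply, Finsupp.add_apply]; omega
    have h3 : (c.1 + e 0 + e 0 - e j) (-j) ≤ N + 2 :=
      ((tsub_le_self : c.1 + e 0 + e 0 - e j ≤ _) (-j)).trans (h2 (-j))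
    have h0' : ((c.1 0 : ℕ) : ℝ) ≤ N := by exact_mod_cast h0
    have h1' : (((c.1 + e 0) 0 : ℕ) : ℝ) ≤ N + 1 := by exact_mod_cast h1
    have h2' : (((c.1 + e 0 + e 0) j : ℕ) : ℝ) ≤ N + 2 := by exact_mod_cast h2 j
    have h3' : (((c.1 + e 0 + e 0 - e j) (-j) : ℕ) : ℝ) ≤ N + 2 := by exact_mod_cast h3
    simp only [norm_mul, Complex.norm_real, Real.norm_eq_abs, abs_of_nonneg (Real.sqrt_nonneg _)]
    have g0 := Real.sqrt_le_sqrt (show ((c.1 0 : ℕ) : ℝ) + 1 ≤ N + 2 by linarith)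
    have g1 := Real.sqrt_le_sqrt (show (((c.1 + e 0) 0 : ℕ) : ℝ) + 1 ≤ N + 2 by linarith)
    have g2 := Real.sqrt_le_sqrt h2'
    have g3 := Real.sqrt_le_sqrt h3'
    exact mul_le_mul_of_nonneg_left (mul_le_mul g0 (mul_le_mul g1 (mul_le_mul g2 g3
      (by positivity) (by positivity)) (by positivity) (by positivity)) (by positivity)
      (by positivity)) (abs_nonneg _)
  · intro a ha b hb hab
    have two : ∀ n : Occ d, (((φ / N : ℝ) : ℂ) * ((Real.sqrt (n 0 + 1) : ℂ) *
        ((Real.sqrt ((n + e 0) 0 + 1) : ℂ) * ((Real.sqrt ((n + e 0 + e 0) j) : ℂ) *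
        (Real.sqrt ((n + e 0 + e 0 - e j) (-j)) : ℂ))))) ≠ 0 → e j + e (-j) ≤ n + e 0 + e 0 := by
      intro n hn
      have hj : (n + e 0 + e 0) j ≠ 0 := by
        intro h; simp [-Finsupp.coe_add, -Pi.add_apply, h] at hn
      have hj' : (n + e 0 + e 0 - e j) (-j) ≠ 0 := by
        intro h; simp [-Finsupp.coe_add, -Finsupp.coe_tsub, h] at hn
      have l1 : e j ≤ n + e 0 + e 0 := by
        simp only [e, Finsupp.single_le_iff] at hj ⊢
        omega
      have l2 : e (-j) ≤ n + e 0 + e 0 - e j := by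
        simp only [e, Finsupp.single_le_iff] at hj' ⊢
        omega
      exact (add_le_add le_rfl l2).trans (add_tsub_cancel_of_le l1).le
    simp only [tsub_tsub] at hab
    have h : a + e 0 + e 0 = b + e 0 + e 0 := by
      rw [← tsub_add_cancel_of_le (two a ha), hab, tsub_add_cancel_of_le (two b hb)]
    exact add_right_cancel (add_right_cancel h)

/-! ### The Feshbach–Schur map -/

section Feshbach

variable {E : Type*} [NormedAddCommGroup E] [InnerProductSpace ℂ E]

/-- `B` is the (bounded, everywhere defined) inverse of `Pb K Pb` on the range of the projection
`Pb`, extended by zero to the complement: `B = Pb (Pb K Pb)⁻¹ Pb`. -/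
def IsReducedInverse (Pb : E →L[ℂ] E) (K : E →ₗ.[ℂ] E) (B : E →L[ℂ] E) : Prop :=
  (∀ ψ, Pb (B ψ) = B ψ) ∧ (∀ ψ, B (Pb ψ) = B ψ) ∧
  (∀ ψ, ∃ h : B ψ ∈ K.domain, Pb (K ⟨B ψ, h⟩) = Pb ψ) ∧
  (∀ ψ, ∀ h : Pb ψ ∈ K.domain, B (Pb (K ⟨Pb ψ, h⟩)) = Pb ψ)

/-- `Pb K Pb` is bounded invertible on the range of `Pb`. -/
def BoundedInvertibleOn (Pb : E →L[ℂ] E) (K : E →ₗ.[ℂ] E) : Prop :=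
  ∃ B : E →L[ℂ] E, IsReducedInverse Pb K B

/-- `Pb (Pb K Pb)⁻¹ Pb` (junk value `0` if `Pb K Pb` is not bounded invertible). -/
def reducedInverse (Pb : E →L[ℂ] E) (K : E →ₗ.[ℂ] E) : E →L[ℂ] E := by
  classical
  exact if h : BoundedInvertibleOn Pb K then h.choose else 0

theorem reducedInverse_mem (Pb : E →L[ℂ] E) (K : E →ₗ.[ℂ] E) (ψ : E) :
    reducedInverse Pb K ψ ∈ K.domain := by
  unfold reducedInverse
  split_ifs with h
  · exact (h.choose_spec.2.2.1 ψ).1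
  · simp

/-- The Feshbach–Schur map `P K P - P K Pb (Pb K Pb)⁻¹ Pb K P`, as an operator on the whole space
which vanishes on the kernel of `P`; its domain is `{ψ : P ψ ∈ D(K)}`. -/
def feshbach (P Pb : E →L[ℂ] E) (K : E →ₗ.[ℂ] E) : E →ₗ.[ℂ] E where
  domain := K.domain.comap (P : E →ₗ[ℂ] E)
  toFun :=
    { toFun := fun ψ => P (K ⟨P ψ, ψ.2⟩) -
        P (K ⟨reducedInverse Pb K (Pb (K ⟨P ψ, ψ.2⟩)), reducedInverse_mem Pb K _⟩)
      map_add' := by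
        intro ψ χ
        have h1 : K ⟨P (ψ + χ : K.domain.comap (P : E →ₗ[ℂ] E)), (ψ + χ).2⟩
            = K ⟨P ψ, ψ.2⟩ + K ⟨P χ, χ.2⟩ := by
          refine Eq.trans ?_ (LinearPMap.map_add K _ _)
          refine congrArg K.toFun (Subtype.ext ?_)
          simp
        simp only [h1]
        have h2 : K ⟨reducedInverse Pb K (Pb (K ⟨P ψ, ψ.2⟩ + K ⟨P χ, χ.2⟩)),
              reducedInverse_mem Pb K _⟩
            = K ⟨reducedInverse Pb K (Pb (K ⟨P ψ, ψ.2⟩)), reducedInverse_mem Pb K _⟩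
              + K ⟨reducedInverse Pb K (Pb (K ⟨P χ, χ.2⟩)), reducedInverse_mem Pb K _⟩ := by
          refine Eq.trans ?_ (LinearPMap.map_add K _ _)
          refine congrArg K.toFun (Subtype.ext ?_)
          simp
        rw [h2, map_add, map_add]
        abel
      map_smul' := by
        intro r ψ
        have h1 : K ⟨P (r • ψ : K.domain.comap (P : E →ₗ[ℂ] E)), (r • ψ).2⟩
            = r • K ⟨P ψ, ψ.2⟩ := by
          refine Eq.trans ?_ (LinearPMap.map_smul K _ _)
          refine congrArg K.toFun (Subtype.ext ?_)
          simp
        simp only [h1]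
        have h2 : K ⟨reducedInverse Pb K (Pb (r • K ⟨P ψ, ψ.2⟩)), reducedInverse_mem Pb K _⟩
            = r • K ⟨reducedInverse Pb K (Pb (K ⟨P ψ, ψ.2⟩)), reducedInverse_mem Pb K _⟩ := by
          refine Eq.trans ?_ (LinearPMap.map_smul K _ _)
          refine congrArg K.toFun (Subtype.ext ?_)
          simp
        rw [h2, map_smul, map_smul, RingHom.id_apply, smul_sub] }

end Feshbach

/-! ### The Feshbach–Schur flow of the three-modes Hamiltonian -/

section Flow

variable {d : ℕ} (N : ℕ) (L φ : ℝ) (js : Mode d)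

/-- `H^{Bog}_{j⋆} - z` on the `N`-particle space. -/
def hBogSub (z : ℝ) : FockN d N →ₗ.[ℂ] FockN d N :=
  realize N (hBogFormal N L φ js - (z : ℂ) • (1 : FormalOp d))

/-- `W_{j⋆}` on the `N`-particle space. -/
def W : FockN d N →L[ℂ] FockN d N := boundedOp N (wFormal N φ js)

/-- `W_{j⋆}^*` on the `N`-particle space. -/
def Wst : FockN d N →L[ℂ] FockN d N := boundedOp N (wStarFormal N φ js)

/-- `Q^{(i,i+1)}`: exactly `N - i` or `N - i - 1` particles in the modes `± j⋆`. -/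
def Q (i : ℕ) : FockN d N →L[ℂ] FockN d N :=
  boundedOp N (cutFormal {n | pairNum js n + i = N ∨ pairNum js n + i + 1 = N})

/-- `Q^{(>i+1)}`: less than `N - i - 1` particles in the modes `± j⋆`. -/
def Qgt (i : ℕ) : FockN d N →L[ℂ] FockN d N :=
  boundedOp N (cutFormal {n | pairNum js n + i + 1 < N})

/-- `flow (t + 1) = 𝒦^{Bog (2t)}(z)`, and `flow 0 = 𝒦^{Bog (-2)}(z) = H^{Bog}_{j⋆} - z`. -/
def flow (z : ℝ) : ℕ → (FockN d N →ₗ.[ℂ] FockN d N)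
  | 0 => hBogSub N L φ js z
  | t + 1 => feshbach (Qgt N js (2 * t)) (Q N js (2 * t)) (flow z t)

/-- `R^{Bog}_{i,i}(z) = Q^{(i,i+1)} (Q^{(i,i+1)} (H^{Bog}_{j⋆} - z) Q^{(i,i+1)})⁻¹ Q^{(i,i+1)}`. -/
def R (z : ℝ) (i : ℕ) : FockN d N →L[ℂ] FockN d N :=
  reducedInverse (Q N js i) (hBogSub N L φ js z)

/-- `W_{i,i'} = Q^{(i,i+1)} W Q^{(i',i'+1)}`. -/
def Wii (i i' : ℕ) : FockN d N →L[ℂ] FockN d N := Q N js i * W N φ js * Q N js i'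

/-- `W^*_{i,i'} = Q^{(i,i+1)} W^* Q^{(i',i'+1)}`. -/
def Wstii (i i' : ℕ) : FockN d N →L[ℂ] FockN d N := Q N js i * Wst N φ js * Q N js i'

/-- `Gam z t = Γ^{Bog}_{2t,2t}(z)`. With the value `0` at `t = 0` the recursion gives
`Γ_{2,2} = W_{2,0} R_{0,0} W^*_{0,2}`. -/
def Gam (z : ℝ) : ℕ → (FockN d N →L[ℂ] FockN d N)
  | 0 => 0
  | t + 1 => Wii N φ js (2 * t + 2) (2 * t) * R N L φ js z (2 * t)
      * (∑' l : ℕ, (Gam z t * R N L φ js z (2 * t)) ^ l) * Wstii N φ js (2 * t) (2 * t + 2)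

/-- `η`: all `N` particles in the zero mode. -/
def eta (d N : ℕ) : FockN d N :=
  lp.single 2 (⟨Finsupp.single 0 N, by simp⟩ : Config d N) (1 : ℂ)

/-- `𝒫_η = |η⟩⟨η|`. -/
def Peta (d N : ℕ) : FockN d N →L[ℂ] FockN d N := InnerProductSpace.rankOne ℂ (eta d N) (eta d N)

/-- The projection complementary to `𝒫_η` in the range of `Q^{(>N-1)}`. -/
def PetaBar : FockN d N →L[ℂ] FockN d N := Qgt N js (N - 2) - Peta d N

/-- `𝒦^{Bog (N-2)}(z)`. -/
def KNm2 (z : ℝ) : FockN d N →ₗ.[ℂ] FockN d N := flow N L φ js z (N / 2)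

/-- The final Feshbach–Schur Hamiltonian `𝒦^{Bog (N)}(z)`. -/
def KN (z : ℝ) : FockN d N →ₗ.[ℂ] FockN d N :=
  feshbach (Peta d N) (PetaBar N js) (KNm2 N L φ js z)

/-- `f(z) = -z - ⟨η, W R_{N-2,N-2}(z) ∑_l [Γ_{N-2,N-2}(z) R_{N-2,N-2}(z)]^l W^* η⟩`. -/
def fFun (z : ℝ) : ℂ :=
  -(z : ℂ) - ⟪eta d N, W N φ js (R N L φ js z (N - 2)
    ((∑' l : ℕ, (Gam N L φ js z (N / 2 - 1) * R N L φ js z (N - 2)) ^ l)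
      (Wst N φ js (eta d N))))⟫_ℂ

/-- All the inverses in `𝒦^{Bog (i)}(z)`, `i = 0, 2, …, N - 2`, and all the resolvents and Neumann
series in `f(z)` exist. -/
def FlowWellDefined (z : ℝ) : Prop :=
  ∀ t < N / 2,
    BoundedInvertibleOn (Q N js (2 * t)) (flow N L φ js z t) ∧
    BoundedInvertibleOn (Q N js (2 * t)) (hBogSub N L φ js z) ∧
    Summable fun l : ℕ => (Gam N L φ js z t * R N L φ js z (2 * t)) ^ l

/-- `ε = k_{j⋆}² / φ`. -/
def eps : ℝ := kSq L js / φ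

/-- `E^{Bog}_{j⋆} = -[k² + φ - √((k²)² + 2 φ k²)]`. -/
def eBog : ℝ :=
  -(kSq L js + φ - Real.sqrt ((kSq L js) ^ 2 + 2 * φ * kSq L js))

/-- `E^{Bog}_{j⋆} + √ε φ √(ε² + 2ε)`. -/
def zMax : ℝ :=
  eBog L φ js + Real.sqrt (eps L φ js) * φ * Real.sqrt ((eps L φ js) ^ 2 + 2 * eps L φ js)

end Flow

end BogThreeModes

end

open BogThreeModes

/-! In the occupation-number basis, `H - z` couples a configuration only to those obtained from it
by moving a pair between the mode `0` and the modes `± j⋆`, so `H - z` is a direct sum of Jacobi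
matrices and the Feshbach–Schur flow is Gaussian elimination in all of them at once. The pivots obey
a two-term recursion in units of `φ`; they determine `Γ` and the reduced operators, and the last
pivot of the sector of `η` is `f`.

With `ε = φ⁻¹ k⋆²` and `v = -z / φ`, comparison with an explicit positive subsolution of the
recursion keeps every pivot that is inverted positive up to `z_max`. The last pivot is strictly
increasing in `v`, and the geometric trial vector `x ^ m` makes it negative at the threshold once
`N ε ^ (3 / 2)` is large; this gives the unique zero of `f`. Finally, the last pivot decreases with
the number of particles available in the modes `0, ± j⋆`, so every other configuration without
particles in `± j⋆`, which carries energy at least `Δ₀`, has last pivot at least `Δ₀ / 2` as long as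
`z ≤ z⋆ + Δ₀ / 2`. -/

noncomputable section

namespace BogThreeModes

section Jacobi

variable {𝕜 : Type*} [Field 𝕜]

/-- The quadratic form `∑_{m < k} (D_m ψ_m² - 2 w_m ψ_m ψ_{m+1})` of the Jacobi matrix with diagonal
`D` and off-diagonal entries `-w`. The last index coupled to, `k`, carries no diagonal term, so that
a Schur complement can be put in its place. -/
def jacobiForm (D w ψ : ℕ → 𝕜) (k : ℕ) : 𝕜 :=
  ∑ m ∈ Finset.range k, (D m * ψ m ^ 2 - 2 * w m * ψ m * ψ (m + 1))

lemma jacobiForm_succ (D w ψ : ℕ → 𝕜) (k : ℕ) : jacobiForm D w ψ (k + 1) =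
    jacobiForm D w ψ k + (D k * ψ k ^ 2 - 2 * w k * ψ k * ψ (k + 1)) :=
  Finset.sum_range_succ _ _

variable {D w κ : ℕ → 𝕜}

lemma jacobiForm_add_eq_add_sum_sq (hκ : ∀ m, κ m = D m - w m ^ 2 / κ (m + 1))
    (h0 : ∀ m, κ (m + 1) ≠ 0) (ψ : ℕ → 𝕜) (k : ℕ) :
    jacobiForm D w ψ k + κ k * ψ k ^ 2 = κ 0 * ψ 0 ^ 2 +
      ∑ m ∈ Finset.range k, (w m * ψ m - κ (m + 1) * ψ (m + 1)) ^ 2 / κ (m + 1) := by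
  induction k with
  | zero => simp [jacobiForm]
  | succ k ih =>
    have hk := h0 k
    rw [jacobiForm_succ, Finset.sum_range_succ, ← add_assoc, ← ih, hκ k]
    field_simp
    ring

lemma jacobiForm_add_eq_of_recurrence (hκ : ∀ m, κ m = D m - w m ^ 2 / κ (m + 1))
    (h0 : ∀ m, κ (m + 1) ≠ 0) {ψ : ℕ → 𝕜} (hψ : ∀ m, ψ (m + 1) = ψ m * (w m / κ (m + 1)))
    (k : ℕ) : jacobiForm D w ψ k + κ k * ψ k ^ 2 = κ 0 * ψ 0 ^ 2 := by
  rw [jacobiForm_add_eq_add_sum_sq hκ h0, Finset.sum_eq_zero, add_zero]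
  intro m _
  have hm := h0 m
  rw [hψ m]
  field_simp
  ring

lemma mul_sq_le_jacobiForm_add [LinearOrder 𝕜] [IsStrictOrderedRing 𝕜]
    (hκ : ∀ m, κ m = D m - w m ^ 2 / κ (m + 1)) (hpos : ∀ m, 0 < κ (m + 1)) (ψ : ℕ → 𝕜) (k : ℕ) :
    κ 0 * ψ 0 ^ 2 ≤ jacobiForm D w ψ k + κ k * ψ k ^ 2 := by
  rw [jacobiForm_add_eq_add_sum_sq hκ fun m => (hpos m).ne']
  exact le_add_of_nonneg_right
    (Finset.sum_nonneg fun m _ => div_nonneg (sq_nonneg _) (hpos m).le)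

end Jacobi

section Pivot

/-- The Schur complements of the Jacobi blocks of the three-modes Hamiltonian minus `z`, in units of
`φ`: `pivot N ε v n a b` is left at a configuration with `n` particles in the mode `0` and `a`, `b`
particles in the modes `± j⋆` once all configurations with more pairs have been eliminated. Here `v`
stands for `(E - z) / φ`, with `E` the energy of the particles outside the modes `0, ± j⋆`. -/
def pivot (N ε v : ℝ) : ℕ → ℕ → ℕ → ℝ
  | 0, a, b => ε * (a + b) + v
  | 1, a, b => (ε + 1 / N) * (a + b) + v
  | n + 2, a, b => (ε + (n + 2) / N) * (a + b) + v
      - (n + 2) * (n + 1) * (a + 1) * (b + 1) / N ^ 2 / pivot N ε v n (a + 1) (b + 1)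

lemma pivot_eq (N ε v : ℝ) (n a b : ℕ) :
    pivot N ε v n a b = (ε + n / N) * (a + b) + v
      - n * (n - 1) * (a + 1) * (b + 1) / N ^ 2 / pivot N ε v (n - 2) (a + 1) (b + 1) := by
  match n with
  | 0 => simp [pivot]
  | 1 => simp [pivot]
  | n + 2 =>
    rw [pivot]
    push_cast
    rw [show (n : ℝ) + 2 - 1 = n + 1 by ring]

/-- The Bogoliubov parameters `e = √ε`, `s = √(ε² + 2ε)` and `x = 1 + ε - s` for small `ε`. In units
of `φ` the Bogoliubov energy is `-x` and the threshold `z_max` is `-(x - e * s)`. The number `x` is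
the smaller root of `x² - 2 (1 + ε) x + 1`, that is, the ratio of the geometric ground state of the
Jacobi matrices in the limit `N → ∞`. -/
structure BogParam (e s x : ℝ) : Prop where
  e_pos : 0 < e
  e_le : e ≤ 1 / 10
  s_pos : 0 < s
  s_sq : s ^ 2 = e ^ 4 + 2 * e ^ 2
  x_eq : x = 1 + e ^ 2 - s

namespace BogParam

variable {e s x : ℝ}

lemma le_s (h : BogParam e s x) : 7 / 5 * e ≤ s := by
  refine le_of_sq_le_sq ?_ h.s_pos.le
  nlinarith [h.s_sq, sq_nonneg (e ^ 2)]

lemma s_le (h : BogParam e s x) : s ≤ 3 / 2 * e := by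
  have he := h.e_pos
  have he2 : e ^ 2 ≤ 1 / 100 := by nlinarith [h.e_le]
  refine le_of_sq_le_sq ?_ (by positivity)
  nlinarith [h.s_sq, sq_nonneg e]

lemma le_x (h : BogParam e s x) : 17 / 20 ≤ x := by
  nlinarith [h.s_le, h.e_le, h.x_eq, sq_nonneg e]

lemma x_pos (h : BogParam e s x) : 0 < x := by linarith [h.le_x]

lemma x_lt_one (h : BogParam e s x) : x < 1 := by
  nlinarith [h.le_s, h.e_le, h.x_eq, h.e_pos, sq_nonneg e]

lemma one_div_x (h : BogParam e s x) : 1 / x = 2 + 2 * e ^ 2 - x := by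
  rw [div_eq_iff h.x_pos.ne', h.x_eq]
  linear_combination h.s_sq

lemma one_sub_x_sq (h : BogParam e s x) : 1 - x ^ 2 = 2 * s * x := by
  rw [h.x_eq]
  linear_combination h.s_sq

lemma e_mul_s_le (h : BogParam e s x) : e * s ≤ 3 / 200 := by
  nlinarith [h.s_le, h.e_le, h.e_pos]

lemma le_threshold (h : BogParam e s x) : 4 / 5 ≤ x - e * s := by
  linarith [h.le_x, h.e_mul_s_le]

lemma comparison_step (h : BogParam e s x) {p q t : ℝ} (hp : 1 ≤ p) (hq : 0 ≤ q)
    (ht : 0 ≤ t) (hpt : p * t ≤ 1 - q) :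
    (q + t) * (p / (2 * x) - e) ≤ (e ^ 2 + q) * p + (x - e * s)
      - q * (x * ((p + 2) / 2) + e * x ^ 2 + 3 / 4 * e ^ 2) := by
  have he := h.e_pos
  have hx := h.le_x
  have hp0 : 0 ≤ p * t := by positivity
  have hq1 : 0 ≤ 1 - q := by linarith
  have hinv : p / (2 * x) = p / 2 * (2 + 2 * e ^ 2 - x) := by
    rw [← h.one_div_x]; field_simp
  have hsplit : (e ^ 2 + q) * p + (x - e * s)
        - q * (x * ((p + 2) / 2) + e * x ^ 2 + 3 / 4 * e ^ 2) - (q + t) * (p / (2 * x) - e)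
      = p * e ^ 2 * (1 - q) + t * e + q * e * (2 * s * x - s - 3 / 4 * e)
        + ((1 - q) * (x - e * s) - p * t * ((2 + 2 * e ^ 2 - x) / 2)) := by
    rw [hinv]
    linear_combination q * e * h.one_sub_x_sq
  have hslope : 0 ≤ q * e * (2 * s * x - s - 3 / 4 * e) := by
    have : 0 ≤ 2 * s * x - s - 3 / 4 * e := by nlinarith [h.le_s]
    positivity
  have hrest : p * t * ((2 + 2 * e ^ 2 - x) / 2) ≤ (1 - q) * (x - e * s) := by
    have : 2 + 2 * e ^ 2 - x ≤ 118 / 100 := by nlinarith [h.e_le]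
    exact mul_le_mul hpt (by linarith [h.le_threshold]) (by linarith [h.x_lt_one, sq_nonneg e]) hq1
  have : 0 ≤ p * e ^ 2 * (1 - q) := by positivity
  have : 0 ≤ t * e := by positivity
  linarith

lemma sq_div_comparison_le (h : BogParam e s x) {A : ℝ} (hA : 3 / 2 ≤ A) :
    A ^ 2 / (A / x - e) ≤ x * A + e * x ^ 2 + 3 / 4 * e ^ 2 := by
  have hx := h.x_pos
  have hx1 := h.x_lt_one
  have he := h.e_le
  have hA1 : A ≤ A / x := by
    rw [le_div_iff₀ hx]; nlinarith
  have hsq : x ^ 2 ≤ 1 := by nlinarith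
  have hdiff : (x * A + e * x ^ 2 + 3 / 4 * e ^ 2) * (A / x - e) - A ^ 2
      = e ^ 2 * (3 / 4 * (A / x) - x ^ 2 - 3 / 4 * e) := by
    field_simp
    ring
  rw [div_le_iff₀ (by linarith), ← sub_nonneg, hdiff]
  exact mul_nonneg (sq_nonneg e) (by linarith)

lemma le_comparison (h : BogParam e s x) {p : ℝ} (hp : 1 ≤ p) : 2 / 5 ≤ p / (2 * x) - e := by
  have : p / 2 ≤ p / (2 * x) :=
    div_le_div_of_nonneg_left (by linarith) (by linarith [h.x_pos]) (by linarith [h.x_lt_one])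
  linarith [h.e_le]

lemma hopTerm_le (h : BogParam e s x) {N n a b g : ℝ} (hN : 0 < N) (hn : 0 ≤ n)
    (hab : 1 ≤ a + b) (hg : (n + 1) / N * ((a + b + 2) / (2 * x) - e) ≤ g) :
    (n + 2) * (n + 1) * (a + 1) * (b + 1) / N ^ 2 / g
      ≤ (n + 2) / N * (x * ((a + b + 2) / 2) + e * x ^ 2 + 3 / 4 * e ^ 2) := by
  have hc : 0 < (a + b + 2) / (2 * x) - e := by
    linarith [h.le_comparison (p := a + b + 2) (by linarith)]
  have hamgm : (a + 1) * (b + 1) ≤ ((a + b + 2) / 2) ^ 2 := by nlinarith [sq_nonneg (a - b)]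
  calc (n + 2) * (n + 1) * (a + 1) * (b + 1) / N ^ 2 / g
      ≤ (n + 2) * (n + 1) * ((a + b + 2) / 2) ^ 2 / N ^ 2
        / ((n + 1) / N * ((a + b + 2) / (2 * x) - e)) := by
        rw [mul_assoc _ (a + 1)]
        gcongr
    _ = (n + 2) / N * (((a + b + 2) / 2) ^ 2 / ((a + b + 2) / (2 * x) - e)) := by
        generalize (a + b + 2) / (2 * x) - e = y at hc ⊢
        field_simp
    _ = (n + 2) / N * (((a + b + 2) / 2) ^ 2 / ((a + b + 2) / 2 / x - e)) := by rw [div_div]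
    _ ≤ (n + 2) / N * (x * ((a + b + 2) / 2) + e * x ^ 2 + 3 / 4 * e ^ 2) := by
        gcongr
        exact h.sq_div_comparison_le (by linarith)

lemma comparison_le_pivot (h : BogParam e s x) {N v : ℝ} (hN : 0 < N) (hv : x - e * s ≤ v)
    (n : ℕ) : ∀ a b : ℕ, 1 ≤ a + b → (n : ℝ) + a + b ≤ N →
    (n + 1) / N * ((a + b) / (2 * x) - e) + (v - (x - e * s)) ≤ pivot N (e ^ 2) v n a b := by
  induction n using Nat.strong_induction_on with
  | _ n ih =>
  intro a b hab hle
  have he := h.e_pos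
  have hx := h.x_pos
  have hp : (1 : ℝ) ≤ a + b := by exact_mod_cast hab
  have hstep := h.comparison_step (q := n / N) (t := 1 / N) hp (by positivity) (by positivity) (by
    rw [le_sub_iff_add_le, show ((a : ℝ) + b) * (1 / N) + n / N = (n + a + b) / N by ring]
    exact div_le_one_of_le₀ hle hN.le)
  rw [← add_div] at hstep
  suffices hhop : (n : ℝ) * (n - 1) * (a + 1) * (b + 1) / N ^ 2
      / pivot N (e ^ 2) v (n - 2) (a + 1) (b + 1)
      ≤ n / N * (x * ((a + b + 2) / 2) + e * x ^ 2 + 3 / 4 * e ^ 2) by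
    rw [pivot_eq]; linarith
  match n, ih with
  | 0, _ => simp
  | 1, _ => simp only [Nat.cast_one, sub_self, mul_zero, zero_mul, zero_div]; positivity
  | n + 2, ih =>
    have hprev := ih n (by omega) (a + 1) (b + 1) (by omega) (by push_cast at hle ⊢; linarith)
    push_cast at hprev ⊢
    rw [show (n : ℝ) + 2 - 1 = n + 1 by ring]
    rw [show (a : ℝ) + 1 + (b + 1) = a + b + 2 by ring] at hprev
    exact h.hopTerm_le hN n.cast_nonneg hp (by linarith)

lemma inv_add_sub_threshold_le_pivot (h : BogParam e s x) {N v : ℝ} (hN : 0 < N)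
    (hv : x - e * s ≤ v) {n a b : ℕ} (hab : 1 ≤ a + b) (hle : (n : ℝ) + a + b ≤ N) :
    1 / N * (2 / 5) + (v - (x - e * s)) ≤ pivot N (e ^ 2) v n a b := by
  have hc := h.le_comparison (p := a + b) (by exact_mod_cast hab)
  have : 1 / N * (2 / 5) ≤ (n + 1) / N * (((a : ℝ) + b) / (2 * x) - e) := by
    gcongr
    linarith [(n.cast_nonneg : (0 : ℝ) ≤ n)]
  linarith [h.comparison_le_pivot hN hv n a b hab hle]

lemma pivot_pos (h : BogParam e s x) {N v : ℝ} (hN : 0 < N) (hv : x - e * s ≤ v) {n a b : ℕ}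
    (hab : 1 ≤ a + b) (hle : (n : ℝ) + a + b ≤ N) : 0 < pivot N (e ^ 2) v n a b := by
  have : 0 < 1 / N * (2 / 5) := by positivity
  linarith [h.inv_add_sub_threshold_le_pivot hN hv hab hle]

lemma pivot_add_sub_le_pivot (h : BogParam e s x) {N v v' : ℝ} (hN : 0 < N) (hv : x - e * s ≤ v)
    (hvv : v ≤ v') (n : ℕ) : ∀ a b : ℕ, (n : ℝ) + a + b ≤ N →
    pivot N (e ^ 2) v n a b + (v' - v) ≤ pivot N (e ^ 2) v' n a b := by
  induction n using Nat.strong_induction_on with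
  | _ n ih =>
  intro a b hle
  match n, ih with
  | 0, _ => simp [pivot]
  | 1, _ => simp [pivot]
  | n + 2, ih =>
    have hle' : (n : ℝ) + (a + 1 : ℕ) + (b + 1 : ℕ) ≤ N := by push_cast at hle ⊢; linarith
    have hpos := h.pivot_pos hN hv (by omega : 1 ≤ (a + 1) + (b + 1)) hle'
    have hmono := ih n (by omega) (a + 1) (b + 1) hle'
    have hhop : ((n : ℝ) + 2) * (n + 1) * (a + 1) * (b + 1) / N ^ 2
          / pivot N (e ^ 2) v' n (a + 1) (b + 1)
        ≤ ((n : ℝ) + 2) * (n + 1) * (a + 1) * (b + 1) / N ^ 2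
          / pivot N (e ^ 2) v n (a + 1) (b + 1) :=
      div_le_div_of_nonneg_left (by positivity) hpos (by linarith)
    rw [pivot, pivot]
    linarith

lemma pivot_strictMonoOn (h : BogParam e s x) {N : ℝ} (hN : 0 < N) {n a b : ℕ}
    (hle : (n : ℝ) + a + b ≤ N) :
    StrictMonoOn (fun v => pivot N (e ^ 2) v n a b) (Set.Ici (x - e * s)) := by
  intro v hv v' _ hlt
  have := h.pivot_add_sub_le_pivot hN hv hlt.le n a b hle
  change pivot N (e ^ 2) v n a b < pivot N (e ^ 2) v' n a b
  linarith

lemma pivot_continuousOn (h : BogParam e s x) {N : ℝ} (hN : 0 < N) (n : ℕ) :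
    ∀ a b : ℕ, (n : ℝ) + a + b ≤ N →
    ContinuousOn (fun v => pivot N (e ^ 2) v n a b) (Set.Ici (x - e * s)) := by
  induction n using Nat.strong_induction_on with
  | _ n ih =>
  intro a b hle
  match n, ih with
  | 0, _ => simp only [pivot]; fun_prop
  | 1, _ => simp only [pivot]; fun_prop
  | n + 2, ih =>
    have hle' : (n : ℝ) + (a + 1 : ℕ) + (b + 1 : ℕ) ≤ N := by push_cast at hle ⊢; linarith
    simp only [pivot]
    exact ContinuousOn.sub (by fun_prop) (continuousOn_const.div (ih n (by omega) _ _ hle')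
      fun v hv => (h.pivot_pos hN hv (by omega) hle').ne')

end BogParam

/-- Diagonal entries of the Jacobi block with `M` particles in the modes `0, ± j⋆` and equally many
particles in `j⋆` and `-j⋆`; the index `m` counts the pairs. -/
def chainDiag (N ε v : ℝ) (M m : ℕ) : ℝ :=
  (ε + ((M - 2 * m : ℕ) : ℝ) / N) * (m + m) + v

/-- Off-diagonal entries of the block of `chainDiag`, between `m` and `m + 1` pairs. -/
def chainHop (N : ℝ) (M m : ℕ) : ℝ :=
  √(((M - 2 * m : ℕ) : ℝ) * (((M - 2 * m : ℕ) : ℝ) - 1)) * (m + 1) / N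

lemma natCast_mul_sub_one_nonneg (n : ℕ) : (0 : ℝ) ≤ n * ((n : ℝ) - 1) := by
  rcases Nat.eq_zero_or_pos n with rfl | hn
  · simp
  · have : (1 : ℝ) ≤ n := by exact_mod_cast hn
    exact mul_nonneg n.cast_nonneg (by linarith)

lemma chainHop_sq (N : ℝ) (M m : ℕ) : chainHop N M m ^ 2 =
    ((M - 2 * m : ℕ) : ℝ) * (((M - 2 * m : ℕ) : ℝ) - 1) * (m + 1) * (m + 1) / N ^ 2 := by
  rw [chainHop, div_pow, mul_pow, Real.sq_sqrt (natCast_mul_sub_one_nonneg _)]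
  ring

lemma pivot_eq_chainDiag_sub (N ε v : ℝ) (M m : ℕ) : pivot N ε v (M - 2 * m) m m =
    chainDiag N ε v M m - chainHop N M m ^ 2 / pivot N ε v (M - 2 * (m + 1)) (m + 1) (m + 1) := by
  rw [pivot_eq, chainHop_sq, chainDiag, show M - 2 * m - 2 = M - 2 * (m + 1) by omega]

lemma chainHop_nonneg {N : ℝ} (hN : 0 ≤ N) (M m : ℕ) : 0 ≤ chainHop N M m := by
  unfold chainHop; positivity

lemma chainHop_eq_zero (N : ℝ) {M m : ℕ} (h : M < 2 * m + 2) : chainHop N M m = 0 := by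
  have : M - 2 * m = 0 ∨ M - 2 * m = 1 := by omega
  rcases this with h | h <;> simp [chainHop, h]

lemma natCast_sub_two_mul {M m : ℕ} (h : 2 * m ≤ M) : ((M - 2 * m : ℕ) : ℝ) = M - 2 * m := by
  push_cast [Nat.cast_sub h]; rfl

lemma sqrt_mul_sub_one_add_sub_le {y z : ℝ} (hy : 1 ≤ y) (hz : y ≤ z) :
    √(y * (y - 1)) + (z - y) ≤ √(z * (z - 1)) := by
  have hle : √(y * (y - 1)) ≤ y - 1 / 2 :=
    Real.sqrt_le_iff.mpr ⟨by linarith, by nlinarith⟩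
  have hsq := Real.sq_sqrt (show 0 ≤ y * (y - 1) by nlinarith)
  exact Real.le_sqrt_of_sq_le (by nlinarith)

lemma sub_one_le_sqrt_mul_sub_one (n : ℕ) : (n : ℝ) - 1 ≤ √(n * ((n : ℝ) - 1)) := by
  rcases Nat.eq_zero_or_pos n with rfl | hn
  · simp
  · have : (1 : ℝ) ≤ n := by exact_mod_cast hn
    exact Real.le_sqrt_of_sq_le (by nlinarith)

lemma sqrt_add_two_mul_add_one_le {t : ℝ} (ht : 0 ≤ t) : √((t + 2) * (t + 1)) ≤ t + 3 / 2 :=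
  Real.sqrt_le_iff.mpr ⟨by linarith, by nlinarith⟩

lemma sum_range_geom_telescope {R : Type*} [CommRing R] (q : R) (k : ℕ) :
    ∑ m ∈ Finset.range k, (m * (1 - q) - q) * q ^ m = -(k * q ^ k) := by
  induction k with
  | zero => simp
  | succ k ih => rw [Finset.sum_range_succ, ih]; push_cast; ring

namespace BogParam

variable {e s x : ℝ}

lemma chain_pivot_pos (h : BogParam e s x) {N v : ℝ} (hN : 0 < N) (hv : x - e * s ≤ v) {M : ℕ}
    (hM : M ≤ N) (m : ℕ) : 0 < pivot N (e ^ 2) v (M - 2 * (m + 1)) (m + 1) (m + 1) := by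
  by_cases hm : 2 * (m + 1) ≤ M
  · refine h.pivot_pos hN hv (by omega) ?_
    rw [natCast_sub_two_mul hm]
    push_cast
    linarith
  · have : 0 < v := by linarith [h.le_threshold]
    rw [show M - 2 * (m + 1) = 0 by omega, pivot]
    positivity

lemma pivot_le_sum_geom (h : BogParam e s x) {N v : ℝ} (hN : 0 < N) (hv : x - e * s ≤ v) {M : ℕ}
    (hM : M ≤ N) (r : ℝ) : pivot N (e ^ 2) v M 0 0 ≤ ∑ m ∈ Finset.range (M / 2 + 1),
      (chainDiag N (e ^ 2) v M m - 2 * chainHop N M m * r) * (r ^ 2) ^ m := by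
  have hform := mul_sq_le_jacobiForm_add (pivot_eq_chainDiag_sub N (e ^ 2) v M)
    (h.chain_pivot_pos hN hv hM) (fun m => r ^ m) (M / 2)
  have hlast : chainHop N M (M / 2) = 0 := chainHop_eq_zero N (by omega)
  rw [pivot_eq_chainDiag_sub N _ _ M (M / 2), hlast] at hform
  simp only [mul_zero, Nat.sub_zero, pow_zero, one_pow, mul_one] at hform
  refine hform.trans_eq ?_
  rw [Finset.sum_range_succ, hlast, jacobiForm]
  congr 1
  · exact Finset.sum_congr rfl fun m _ => by ring
  · ring

/-- The `N → ∞` limit of the left-hand side is `m * (1 / x - x) - x - e * s`, whose first part is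
the telescoping `1 / x * (m * (1 - x ^ 2) - x ^ 2)`; the correction `(6 * m + 2) / N` is split the
same way, up to a constant. -/
lemma geom_coeff_le (h : BogParam e s x) {N : ℕ} (hN : 0 < N) {m : ℕ} (hm : 2 * m ≤ N) :
    chainDiag N (e ^ 2) (x - e * s) N m - 2 * chainHop N N m * x ≤
      (1 / x + 3 / (x * (N * s))) * (m * (1 - x ^ 2) - x ^ 2)
        + (3 * x / (N * s) + 2 / N - e * s) := by
  have hN0 : (0 : ℝ) < N := by exact_mod_cast hN
  have hx := h.x_pos
  have hs := h.s_pos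
  have hhop : ((N : ℝ) - 2 * m - 1) * (m + 1) / N ≤ chainHop N N m := by
    have := sub_one_le_sqrt_mul_sub_one (N - 2 * m)
    rw [chainHop]
    rw [natCast_sub_two_mul hm] at this ⊢
    gcongr
  have hlimit : (e ^ 2 + ((N : ℝ) - 2 * m) / N) * (m + m) + (x - e * s)
        - 2 * (((N : ℝ) - 2 * m - 1) * (m + 1) / N) * x
      = m * (1 / x - x) - x - e * s
        + (-(4 * m ^ 2 * (1 - x)) + 4 * m * x + 2 * (m + 1) * x) / N := by
    rw [h.one_div_x]; field_simp; ring
  have hcorr : (-(4 * m ^ 2 * (1 - x)) + 4 * m * x + 2 * (m + 1) * x : ℝ) / N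
      ≤ (6 * m + 2) / N := by
    have hx1 := h.x_lt_one
    have hsq : 0 ≤ 4 * (m : ℝ) ^ 2 * (1 - x) := mul_nonneg (by positivity) (by linarith)
    refine div_le_div_of_nonneg_right ?_ hN0.le
    nlinarith [m.cast_nonneg (α := ℝ)]
  have hsplit : (1 / x + 3 / (x * (N * s))) * (m * (1 - x ^ 2) - x ^ 2)
        + (3 * x / (N * s) + 2 / N - e * s)
      = m * (1 / x - x) - x - e * s + (6 * m + 2) / N := by
    have : 3 / (x * (N * s)) * (m * (1 - x ^ 2)) = 6 * m / N := by
      rw [h.one_sub_x_sq]; field_simp; ring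
    rw [add_mul, mul_sub (3 / (x * (N * s))), this]
    field_simp
    ring
  rw [hsplit, chainDiag, natCast_sub_two_mul hm]
  have : 2 * (((N : ℝ) - 2 * m - 1) * (m + 1) / N) * x ≤ 2 * chainHop N N m * x := by gcongr
  linarith

lemma pivot_neg (h : BogParam e s x) {N : ℕ} (hN : 100 ≤ N * e ^ 3) :
    pivot N (e ^ 2) (x - e * s) N 0 0 < 0 := by
  have he := h.e_pos
  have hx := h.x_pos
  have hs := h.s_pos
  have hN0 : (0 : ℝ) < N := pos_of_mul_pos_left (by linarith) (by positivity : 0 ≤ e ^ 3)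
  set k := N / 2 + 1
  set p := 1 / x + 3 / (x * (N * s))
  set δ := 3 * x / (N * s) + 2 / N - e * s with hδ
  have herror : δ < 0 := by
    have hss : 7 / 5 * e * (7 / 5 * e) ≤ s * s := by gcongr <;> exact h.le_s
    have : N * e * (7 / 5 * e * (7 / 5 * e)) ≤ N * e * (s * s) := by gcongr
    rw [hδ, show 3 * x / (N * s) + 2 / N = (3 * x + 2 * s) / (N * s) by field_simp, sub_neg,
      div_lt_iff₀ (by positivity)]
    nlinarith [h.s_le, h.e_le, h.x_lt_one]
  have hgeom : 1 ≤ ∑ m ∈ Finset.range k, (x ^ 2) ^ m := by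
    have := Finset.single_le_sum (f := fun m => (x ^ 2) ^ m) (fun m _ => by positivity)
      (Finset.mem_range.mpr (by omega : 0 < k))
    simpa using this
  calc pivot N (e ^ 2) (x - e * s) N 0 0
      ≤ ∑ m ∈ Finset.range k, (chainDiag N (e ^ 2) (x - e * s) N m - 2 * chainHop N N m * x)
          * (x ^ 2) ^ m := h.pivot_le_sum_geom hN0 le_rfl le_rfl x
    _ ≤ ∑ m ∈ Finset.range k, (p * (m * (1 - x ^ 2) - x ^ 2) + δ) * (x ^ 2) ^ m := by
        refine Finset.sum_le_sum fun m hm => ?_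
        rw [Finset.mem_range] at hm
        gcongr
        exact h.geom_coeff_le (by exact_mod_cast hN0) (by omega)
    _ = -(p * (k * (x ^ 2) ^ k)) + δ * ∑ m ∈ Finset.range k, (x ^ 2) ^ m := by
        simp only [add_mul, mul_assoc p, Finset.sum_add_distrib, ← Finset.mul_sum,
          sum_range_geom_telescope, mul_neg]
    _ ≤ δ * ∑ m ∈ Finset.range k, (x ^ 2) ^ m := by
        have : 0 ≤ p * (k * (x ^ 2) ^ k) := by positivity
        linarith
    _ < 0 := mul_neg_of_neg_of_pos herror (by linarith)

lemma exists_pivot_eq_zero (h : BogParam e s x) {N : ℕ} (hN : 100 ≤ N * e ^ 3) :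
    ∃ v, x - e * s < v ∧ pivot N (e ^ 2) v N 0 0 = 0 := by
  have he := h.e_pos
  have hN0 : (0 : ℝ) < N := pos_of_mul_pos_left (by linarith) (by positivity : 0 ≤ e ^ 3)
  have hneg := h.pivot_neg hN
  have hle : (N : ℝ) + (0 : ℕ) + (0 : ℕ) ≤ N := by simp
  set v₁ := x - e * s - pivot N (e ^ 2) (x - e * s) N 0 0
  have hpos : 0 ≤ pivot N (e ^ 2) v₁ N 0 0 := by
    linarith [h.pivot_add_sub_le_pivot hN0 le_rfl (by linarith : x - e * s ≤ v₁) N 0 0 hle]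
  obtain ⟨v, ⟨hv, -⟩, hroot⟩ := intermediate_value_Icc (by linarith : x - e * s ≤ v₁)
    ((h.pivot_continuousOn hN0 N 0 0 hle).mono Set.Icc_subset_Ici_self) ⟨hneg.le, hpos⟩
  refine ⟨v, hv.lt_of_ne ?_, hroot⟩
  rintro rfl
  exact hneg.ne hroot

lemma hop_le_pivot_of_lt (h : BogParam e s x) {N v : ℝ} (hN : 5 ≤ N * e) (hv : x - e * s ≤ v)
    {n m : ℕ} (hm : 1 ≤ m) (hle : (n : ℝ) + 2 * m ≤ N) (hlt : (x - e * s) * N < n + m) :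
    m * √(((n : ℝ) + 2) * (n + 1)) / N ≤ pivot N (e ^ 2) v n m m := by
  have he := h.e_pos
  have hN0 : 0 < N := pos_of_mul_pos_left (by linarith) he.le
  have hm1 : (1 : ℝ) ≤ m := by exact_mod_cast hm
  have hc := h.comparison_le_pivot hN0 hv n m m (by omega) (by linarith)
  rw [show ((m : ℝ) + m) / (2 * x) = m * (1 / x) by field_simp; ring, h.one_div_x] at hc
  refine le_trans ?_ ((le_add_of_nonneg_right (by linarith)).trans hc)
  rw [div_mul_eq_mul_div]
  refine div_le_div_of_nonneg_right ?_ hN0.le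
  have hmany : 3 / 5 * N ≤ n := by nlinarith [h.le_threshold]
  have hrate : 1 + 2 / 5 * e ≤ 2 + 2 * e ^ 2 - x - e := by nlinarith [h.le_s, h.x_eq]
  have hn : (n : ℝ) + 3 / 2 ≤ (n + 1) * (1 + 2 / 5 * e) := by nlinarith
  calc (m : ℝ) * √(((n : ℝ) + 2) * (n + 1)) ≤ m * ((n + 1) * (1 + 2 / 5 * e)) := by
        gcongr
        exact (sqrt_add_two_mul_add_one_le n.cast_nonneg).trans hn
    _ ≤ m * ((n + 1) * (2 + 2 * e ^ 2 - x - e)) := by gcongr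
    _ = (n + 1) * (m * (2 + 2 * e ^ 2 - x) - m * e) := by ring
    _ ≤ (n + 1) * (m * (2 + 2 * e ^ 2 - x) - e) := by
        gcongr
        exact le_mul_of_one_le_left he.le hm1

lemma hopTerm_le_of_hop_le {N : ℝ} (hN : 0 < N) {n m g : ℝ} (hn : 0 ≤ n) (hm : 0 ≤ m)
    (hg : (m + 1) * √((n + 2) * (n + 1)) / N ≤ g) :
    (n + 2) * (n + 1) * (m + 1) * (m + 1) / N ^ 2 / g ≤ (m + 1) * (n + 3 / 2) / N := by
  have hw : 0 < (m + 1) * √((n + 2) * (n + 1)) / N := by positivity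
  have hsq : (n + 2) * (n + 1) * (m + 1) * (m + 1) / N ^ 2
      = ((m + 1) * √((n + 2) * (n + 1)) / N) ^ 2 := by
    rw [div_pow, mul_pow, Real.sq_sqrt (by positivity)]; ring
  calc (n + 2) * (n + 1) * (m + 1) * (m + 1) / N ^ 2 / g
      ≤ (m + 1) * √((n + 2) * (n + 1)) / N := by
        rw [hsq, div_le_iff₀ (hw.trans_le hg), sq]
        gcongr
    _ ≤ (m + 1) * (n + 3 / 2) / N := by
        gcongr
        exact sqrt_add_two_mul_add_one_le hn

lemma hop_le_pivot_of_hopTerm_le {N ε v : ℝ} (hN : 0 < N) (hε : 0 ≤ ε) {n m : ℕ}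
    (hv : ((n : ℝ) + m) / N ≤ v)
    (hterm : (n : ℝ) * (n - 1) * (m + 1) * (m + 1) / N ^ 2
      / pivot N ε v (n - 2) (m + 1) (m + 1) ≤ (m + 1) * (n - 1 / 2) / N) :
    m * √(((n : ℝ) + 2) * (n + 1)) / N ≤ pivot N ε v n m m := by
  have hdiag : 0 ≤ ε * ((m : ℝ) + m) := by positivity
  have hhalf : 0 ≤ 1 / 2 / N := by positivity
  have hhop : m * √(((n : ℝ) + 2) * (n + 1)) / N ≤ m * (n + 3 / 2) / N := by
    gcongr
    exact sqrt_add_two_mul_add_one_le n.cast_nonneg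
  have hsum : m * (n + 3 / 2) / N + (m + 1) * (n - 1 / 2) / N
      = n / N * ((m : ℝ) + m) + (n + m) / N - 1 / 2 / N := by ring
  rw [pivot_eq]
  linarith

lemma hop_le_pivot (h : BogParam e s x) {N v : ℝ} (hN : 5 ≤ N * e) (hv : x - e * s ≤ v) (n : ℕ) :
    ∀ m : ℕ, 1 ≤ m → (n : ℝ) + 2 * m ≤ N →
    m * √(((n : ℝ) + 2) * (n + 1)) / N ≤ pivot N (e ^ 2) v n m m := by
  have hN0 : 0 < N := pos_of_mul_pos_left (by linarith) h.e_pos.le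
  induction n using Nat.strong_induction_on with
  | _ n ih =>
  intro m hm hle
  rcases lt_or_ge ((x - e * s) * N) (n + m) with hlt | hge
  · exact h.hop_le_pivot_of_lt hN hv hm hle hlt
  have hlow : ((n : ℝ) + m) / N ≤ v := by
    rw [div_le_iff₀ hN0]; nlinarith
  match n, ih with
  | 0, _ =>
    have hhop : m * √(((0 : ℝ) + 2) * (0 + 1)) / N ≤ m * (0 + 3 / 2) / N := by
      gcongr
      exact sqrt_add_two_mul_add_one_le le_rfl
    have hpair : m * (0 + 3 / 2) / N ≤ v := by
      rw [div_le_iff₀ hN0]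
      push_cast at hle
      nlinarith [h.le_threshold]
    rw [pivot, Nat.cast_zero]
    linarith [mul_nonneg (sq_nonneg e) (add_nonneg m.cast_nonneg (m.cast_nonneg (α := ℝ)))]
  | 1, _ =>
    refine hop_le_pivot_of_hopTerm_le hN0 (sq_nonneg e) hlow ?_
    simp only [Nat.cast_one, sub_self, mul_zero, zero_mul, zero_div]
    positivity
  | n + 2, ih =>
    refine hop_le_pivot_of_hopTerm_le hN0 (sq_nonneg e) hlow ?_
    have hprev := ih n (by omega) (m + 1) (by omega) (by push_cast at hle ⊢; linarith)
    push_cast at hprev ⊢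
    rw [show (n : ℝ) + 2 - 1 = n + 1 by ring, show (n : ℝ) + 2 - 1 / 2 = n + 3 / 2 by ring]
    exact hopTerm_le_of_hop_le hN0 n.cast_nonneg m.cast_nonneg hprev

end BogParam

/-- The unnormalized ground state of the Jacobi block of `chainDiag` and `chainHop`, obtained by
back substitution in the elimination that produces the pivots. -/
def chainVec (N ε v : ℝ) (M m : ℕ) : ℝ :=
  ∏ i ∈ Finset.range m, chainHop N M i / pivot N ε v (M - 2 * (i + 1)) (i + 1) (i + 1)

lemma chainVec_succ (N ε v : ℝ) (M m : ℕ) : chainVec N ε v M (m + 1) = chainVec N ε v M m *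
    (chainHop N M m / pivot N ε v (M - 2 * (m + 1)) (m + 1) (m + 1)) :=
  Finset.prod_range_succ _ _

lemma chainVec_eq_zero (N ε v : ℝ) {M m : ℕ} (hm : M < 2 * m) : chainVec N ε v M m = 0 := by
  obtain ⟨k, rfl⟩ : ∃ k, m = k + 1 := ⟨m - 1, by omega⟩
  rw [chainVec_succ, chainHop_eq_zero N (by omega), zero_div, mul_zero]

lemma sub_mul_le_chainHop_sub {N : ℝ} (hN : 0 ≤ N) {M M' m : ℕ} (hm : 2 * m + 2 ≤ M)
    (hM : M ≤ M') : ((M' : ℝ) - M) / N * (m + 1) ≤ chainHop N M' m - chainHop N M m := by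
  have hM₁ : ((2 * m + 2 : ℕ) : ℝ) ≤ M := by exact_mod_cast hm
  have hM₂ : (M : ℝ) ≤ M' := by exact_mod_cast hM
  push_cast at hM₁
  have hsqrt := sqrt_mul_sub_one_add_sub_le (y := (M : ℝ) - 2 * m) (z := (M' : ℝ) - 2 * m)
    (by linarith) (by linarith)
  rw [chainHop, chainHop, natCast_sub_two_mul (by omega), natCast_sub_two_mul (by omega),
    ← sub_div, ← sub_mul, div_mul_eq_mul_div]
  refine div_le_div_of_nonneg_right (mul_le_mul_of_nonneg_right ?_ (by positivity)) hN
  linarith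

namespace BogParam

variable {e s x : ℝ}

lemma chainVec_nonneg (h : BogParam e s x) {N v : ℝ} (hN : 0 < N) (hv : x - e * s ≤ v) {M : ℕ}
    (hM : M ≤ N) (m : ℕ) : 0 ≤ chainVec N (e ^ 2) v M m :=
  Finset.prod_nonneg fun i _ => div_nonneg (chainHop_nonneg hN.le M i)
    (h.chain_pivot_pos hN hv hM i).le

lemma chainHop_le_pivot (h : BogParam e s x) {N v : ℝ} (hN : 5 ≤ N * e) (hv : x - e * s ≤ v)
    {M : ℕ} (hM : M ≤ N) (m : ℕ) :
    chainHop N M m ≤ pivot N (e ^ 2) v (M - 2 * (m + 1)) (m + 1) (m + 1) := by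
  by_cases hm : M < 2 * m + 2
  · rw [chainHop_eq_zero N hm]
    exact (h.chain_pivot_pos (pos_of_mul_pos_left (by linarith) h.e_pos.le) hv hM m).le
  obtain ⟨n, rfl⟩ : ∃ n, M = n + 2 * (m + 1) := ⟨M - 2 * (m + 1), by omega⟩
  have hhop := h.hop_le_pivot hN hv n (m + 1) (by omega) (by push_cast at hM ⊢; linarith)
  rw [chainHop, Nat.add_sub_cancel, show n + 2 * (m + 1) - 2 * m = n + 2 by omega]
  push_cast at hhop ⊢
  rwa [show (n : ℝ) + 2 - 1 = n + 1 by ring, mul_comm (√_)]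

lemma chainVec_succ_le (h : BogParam e s x) {N v : ℝ} (hN : 5 ≤ N * e) (hv : x - e * s ≤ v)
    {M : ℕ} (hM : M ≤ N) (m : ℕ) :
    chainVec N (e ^ 2) v M (m + 1) ≤ chainVec N (e ^ 2) v M m := by
  have hN0 : 0 < N := pos_of_mul_pos_left (by linarith) h.e_pos.le
  rw [chainVec_succ]
  exact mul_le_of_le_one_right (h.chainVec_nonneg hN0 hv hM m)
    ((div_le_one (h.chain_pivot_pos hN0 hv hM m)).mpr (h.chainHop_le_pivot hN hv hM m))

lemma sub_mul_chainVec_sq_le (h : BogParam e s x) {N v : ℝ} (hN : 5 ≤ N * e)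
    (hv : x - e * s ≤ v) {M M' : ℕ} (hMN : M ≤ N) (hM : M ≤ M') (m : ℕ) :
    ((M' : ℝ) - M) / N * (m + 1) * chainVec N (e ^ 2) v M (m + 1) ^ 2 ≤
      (chainHop N M' m - chainHop N M m)
        * (chainVec N (e ^ 2) v M m * chainVec N (e ^ 2) v M (m + 1)) := by
  have hN0 : 0 < N := pos_of_mul_pos_left (by linarith) h.e_pos.le
  by_cases hm : M < 2 * m + 2
  · simp [chainVec_eq_zero N (e ^ 2) v (by omega : M < 2 * (m + 1))]
  have hhop := sub_mul_le_chainHop_sub hN0.le (not_lt.mp hm) hM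
  have hMM : (M : ℝ) ≤ M' := by exact_mod_cast hM
  have hcoeff : 0 ≤ ((M' : ℝ) - M) / N * (m + 1) :=
    mul_nonneg (div_nonneg (by linarith) hN0.le) (by positivity)
  refine mul_le_mul hhop ?_ (sq_nonneg _) (hcoeff.trans hhop)
  rw [sq]
  exact mul_le_mul_of_nonneg_right (h.chainVec_succ_le hN hv hMN m)
    (h.chainVec_nonneg hN0 hv hMN _)

lemma chain_term_le (h : BogParam e s x) {N v : ℝ} (hN : 5 ≤ N * e) (hv : x - e * s ≤ v)
    {M M' : ℕ} (hMN : M ≤ N) (hM : M ≤ M') {ψ : ℕ → ℝ} (hψ : ψ = chainVec N (e ^ 2) v M) (m : ℕ) :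
    chainDiag N (e ^ 2) v M' m * ψ m ^ 2 - 2 * chainHop N M' m * ψ m * ψ (m + 1) ≤
      chainDiag N (e ^ 2) v M m * ψ m ^ 2 - 2 * chainHop N M m * ψ m * ψ (m + 1)
        + ((M' : ℝ) - M) / N * (2 * m * ψ m ^ 2 - 2 * (m + 1 : ℕ) * ψ (m + 1) ^ 2) := by
  by_cases hm : M < 2 * m
  · rw [hψ, chainVec_eq_zero N _ v hm, chainVec_eq_zero N _ v (by omega : M < 2 * (m + 1))]
    simp
  have hdiag : chainDiag N (e ^ 2) v M' m
      = chainDiag N (e ^ 2) v M m + ((M' : ℝ) - M) / N * (2 * m) := by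
    rw [chainDiag, chainDiag, natCast_sub_two_mul (by omega), natCast_sub_two_mul (by omega)]
    ring
  have hhop := h.sub_mul_chainVec_sq_le hN hv hMN hM m
  rw [← hψ] at hhop
  rw [hdiag]
  push_cast
  linarith

lemma pivot_antitone (h : BogParam e s x) {N v : ℝ} {M M' : ℕ} (hN : 5 ≤ N * e)
    (hv : x - e * s ≤ v) (hM : M ≤ M') (hM' : M' ≤ N) :
    pivot N (e ^ 2) v M' 0 0 ≤ pivot N (e ^ 2) v M 0 0 := by
  have hN0 : 0 < N := pos_of_mul_pos_left (by linarith) h.e_pos.le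
  have hMN : (M : ℝ) ≤ N := le_trans (by exact_mod_cast hM) hM'
  obtain ⟨ψ, hψ⟩ : ∃ ψ, ψ = chainVec N (e ^ 2) v M := ⟨_, rfl⟩
  have hlast : ψ (M + 1) = 0 := hψ ▸ chainVec_eq_zero N _ v (by omega)
  have hground := jacobiForm_add_eq_of_recurrence (ψ := ψ) (pivot_eq_chainDiag_sub N (e ^ 2) v M)
    (fun m => (h.chain_pivot_pos hN0 hv hMN m).ne') (hψ ▸ chainVec_succ N _ v M) (M + 1)
  have htrial := mul_sq_le_jacobiForm_add (pivot_eq_chainDiag_sub N (e ^ 2) v M')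
    (h.chain_pivot_pos hN0 hv hM') ψ (M + 1)
  have hfirst : ψ 0 = 1 := by simp [hψ, chainVec]
  simp only [hlast, hfirst, mul_zero, Nat.sub_zero, ne_eq, OfNat.ofNat_ne_zero,
    not_false_eq_true, zero_pow, add_zero, one_pow, mul_one] at hground htrial
  calc pivot N (e ^ 2) v M' 0 0
      ≤ jacobiForm (chainDiag N (e ^ 2) v M') (chainHop N M') ψ (M + 1) := htrial
    _ ≤ jacobiForm (chainDiag N (e ^ 2) v M) (chainHop N M) ψ (M + 1)
        + ((M' : ℝ) - M) / N * ∑ m ∈ Finset.range (M + 1),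
            (2 * (m : ℝ) * ψ m ^ 2 - 2 * (m + 1 : ℕ) * ψ (m + 1) ^ 2) := by
        rw [jacobiForm, jacobiForm, Finset.mul_sum, ← Finset.sum_add_distrib]
        exact Finset.sum_le_sum fun m _ => h.chain_term_le hN hv hMN hM hψ m
    _ = pivot N (e ^ 2) v M 0 0 := by
        rw [Finset.sum_range_sub' fun m : ℕ => 2 * (m : ℝ) * ψ m ^ 2, hlast, hground]
        simp

lemma sub_le_pivot_of_root (h : BogParam e s x) {N M : ℕ} {v v' : ℝ} (hN : 5 ≤ N * e)
    (hv : x - e * s ≤ v) (hroot : pivot N (e ^ 2) v N 0 0 = 0) (hvv : v ≤ v') (hM : M ≤ N) :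
    v' - v ≤ pivot N (e ^ 2) v' M 0 0 := by
  have hN0 : (0 : ℝ) < N := pos_of_mul_pos_left (by linarith) h.e_pos.le
  have hMN : (M : ℝ) ≤ N := by exact_mod_cast hM
  have hanti := h.pivot_antitone hN hv hM le_rfl
  have hmono := h.pivot_add_sub_le_pivot hN0 hv hvv M 0 0 (by simpa using hMN)
  linarith

end BogParam

end Pivot

section Config

variable {d N : ℕ}

lemma extend_config (ψ : Config d N → ℂ) (c : Config d N) : extend ψ c.1 = ψ c :=
  dif_pos c.2

lemma sum_add_single_one {α : Type*} (n : α →₀ ℕ) (j : α) :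
    ((n + Finsupp.single j 1).sum fun _ m => m) = (n.sum fun _ m => m) + 1 := by
  rw [Finsupp.sum_add_index' (fun _ => rfl) (fun _ _ _ => rfl), Finsupp.sum_single_index rfl]

lemma sum_sub_single_one {α : Type*} {n : α →₀ ℕ} {j : α} (h : n j ≠ 0) :
    ((n - Finsupp.single j 1).sum fun _ m => m) + 1 = n.sum fun _ m => m := by
  rw [← sum_add_single_one, Finsupp.sub_add_single_one_cancel h]

/-- Two particles are moved from the zero mode to the modes `± js`. The subtractions are truncated:
this is only meaningful for `2 ≤ n 0`. -/
def pairUpOcc (js : Mode d) (n : Occ d) : Occ d :=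
  n - Finsupp.single 0 1 - Finsupp.single 0 1 + Finsupp.single js 1 + Finsupp.single (-js) 1

/-- Two particles are moved from the modes `± js` to the zero mode. The subtractions are truncated:
this is only meaningful for `1 ≤ n js` and `1 ≤ n (-js)`. -/
def pairDownOcc (js : Mode d) (n : Occ d) : Occ d :=
  n + Finsupp.single 0 1 + Finsupp.single 0 1 - Finsupp.single js 1 - Finsupp.single (-js) 1

variable {js : Mode d}

lemma pairUpOcc_zero (hjs : js ≠ 0) (n : Occ d) : pairUpOcc js n 0 = n 0 - 2 := by
  simp [pairUpOcc, hjs, Nat.sub_sub]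

lemma pairUpOcc_js (hjs : js ≠ 0) (n : Occ d) : pairUpOcc js n js = n js + 1 := by
  simp [pairUpOcc, hjs.symm, (self_ne_neg.mpr hjs).symm]

lemma pairUpOcc_neg (hjs : js ≠ 0) (n : Occ d) : pairUpOcc js n (-js) = n (-js) + 1 := by
  simp [pairUpOcc, (neg_ne_zero.mpr hjs).symm, self_ne_neg.mpr hjs]

lemma pairDownOcc_js (hjs : js ≠ 0) (n : Occ d) : pairDownOcc js n js = n js - 1 := by
  simp [pairDownOcc, hjs.symm, (self_ne_neg.mpr hjs).symm]

lemma pairDownOcc_neg (hjs : js ≠ 0) (n : Occ d) : pairDownOcc js n (-js) = n (-js) - 1 := by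
  simp [pairDownOcc, (neg_ne_zero.mpr hjs).symm, self_ne_neg.mpr hjs]

lemma pairUpOcc_of_ne {n : Occ d} {j : Mode d} (h0 : j ≠ 0) (h1 : j ≠ js) (h2 : j ≠ -js) :
    pairUpOcc js n j = n j := by
  simp [pairUpOcc, h0.symm, h1.symm, h2.symm]

lemma sum_pairUpOcc {n : Occ d} (h : 2 ≤ n 0) :
    ((pairUpOcc js n).sum fun _ m => m) = n.sum fun _ m => m := by
  rw [pairUpOcc, sum_add_single_one, sum_add_single_one, sum_sub_single_one, sum_sub_single_one]
  · omega
  · simp; omega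

lemma sum_pairDownOcc (hjs : js ≠ 0) {n : Occ d} (h : 1 ≤ n js) (h' : 1 ≤ n (-js)) :
    ((pairDownOcc js n).sum fun _ m => m) = n.sum fun _ m => m := by
  have hsub := sum_sub_single_one (n := n + Finsupp.single 0 1 + Finsupp.single 0 1) (j := js)
    (by simp; omega)
  have hsub' := sum_sub_single_one
    (n := n + Finsupp.single 0 1 + Finsupp.single 0 1 - Finsupp.single js 1) (j := -js)
    (by simp [Finsupp.single_apply, self_ne_neg.mpr hjs]; omega)
  rw [sum_add_single_one, sum_add_single_one] at hsub
  rw [pairDownOcc]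
  omega

lemma pairDownOcc_pairUpOcc {n : Occ d} (h : 2 ≤ n 0) : pairDownOcc js (pairUpOcc js n) = n := by
  have hzero : n - Finsupp.single 0 1 - Finsupp.single 0 1 + Finsupp.single 0 1
      + Finsupp.single 0 1 = n := by
    rw [Finsupp.sub_add_single_one_cancel, Finsupp.sub_add_single_one_cancel]
    · omega
    · simp; omega
  rw [pairDownOcc, pairUpOcc, tsub_tsub]
  apply tsub_eq_of_eq_add
  conv_rhs => rw [← hzero]
  generalize n - Finsupp.single 0 1 - Finsupp.single 0 1 = m
  generalize Finsupp.single (-js) 1 = k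
  abel

variable (js) in
/-- `pairUpOcc` on `N`-particle configurations, with junk value `c` if `c` has fewer than two
particles in the zero mode. -/
def pairUp (c : Config d N) : Config d N :=
  if h : 2 ≤ c.1 0 then ⟨pairUpOcc js c.1, (sum_pairUpOcc h).trans c.2⟩ else c

open Classical in
variable (js) in
/-- `pairDownOcc` on `N`-particle configurations, with junk value `c` if the truncated subtractions
do not preserve the number of particles. -/
def pairDown (c : Config d N) : Config d N :=
  if h : ((pairDownOcc js c.1).sum fun _ m => m) = N then ⟨pairDownOcc js c.1, h⟩ else c

lemma pairUp_val {c : Config d N} (h : 2 ≤ c.1 0) : (pairUp js c).1 = pairUpOcc js c.1 := by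
  rw [pairUp, dif_pos h]

lemma pairDown_val (hjs : js ≠ 0) {c : Config d N} (h : 1 ≤ c.1 js) (h' : 1 ≤ c.1 (-js)) :
    (pairDown js c).1 = pairDownOcc js c.1 := by
  rw [pairDown, dif_pos ((sum_pairDownOcc hjs h h').trans c.2)]

lemma pairDown_pairUp (hjs : js ≠ 0) {c : Config d N} (h : 2 ≤ c.1 0) :
    pairDown js (pairUp js c) = c := by
  have hval := pairUp_val (js := js) h
  refine Subtype.ext ?_
  rw [pairDown_val hjs (by rw [hval, pairUpOcc_js hjs]; omega)
    (by rw [hval, pairUpOcc_neg hjs]; omega), hval, pairDownOcc_pairUpOcc h]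

lemma pairNum_pairUp (hjs : js ≠ 0) {c : Config d N} (h : 2 ≤ c.1 0) :
    pairNum js (pairUp js c).1 = pairNum js c.1 + 2 := by
  rw [pairUp_val h, pairNum, pairUpOcc_js hjs, pairUpOcc_neg hjs, pairNum]
  omega

lemma pairNum_pairDown (hjs : js ≠ 0) {c : Config d N} (h : 1 ≤ c.1 js) (h' : 1 ≤ c.1 (-js)) :
    pairNum js (pairDown js c).1 + 2 = pairNum js c.1 := by
  rw [pairDown_val hjs h h', pairNum, pairDownOcc_js hjs, pairDownOcc_neg hjs, pairNum]
  omega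

lemma occ_add_pairNum_le (hjs : js ≠ 0) (c : Config d N) :
    c.1 0 + (c.1 js + c.1 (-js)) ≤ N := by
  classical
  have h : ∑ j ∈ {0, js, -js}, c.1 j ≤ N :=
    (Finset.sum_le_sum_of_ne_zero fun j _ hj => Finsupp.mem_support_iff.mpr hj).trans c.2.le
  rwa [Finset.sum_insert (by simp [hjs.symm, (neg_ne_zero.mpr hjs).symm]),
    Finset.sum_insert (by simpa using self_ne_neg.mpr hjs), Finset.sum_singleton] at h

lemma pairNum_le (hjs : js ≠ 0) (c : Config d N) : pairNum js c.1 ≤ N :=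
  (Nat.le_add_left _ _).trans (occ_add_pairNum_le hjs c)

end Config

section MatrixElements

variable {d : ℕ} (N : ℕ) (L φ : ℝ) (js : Mode d)

/-- Matrix element of `W` between `n` and `pairUpOcc js n`. -/
def hop (n : Occ d) : ℝ :=
  φ / N * √((n 0 : ℝ) * ((n 0 : ℝ) - 1) * (n js + 1) * (n (-js) + 1))

/-- Matrix element of `W^*` between `n` and `pairDownOcc js n`. -/
def hopDown (n : Occ d) : ℝ :=
  φ / N * √(((n 0 : ℝ) + 2) * ((n 0 : ℝ) + 1) * n js * n (-js))

/-- The kinetic energy of the particles outside the modes `± js`. -/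
def restEnergy (n : Occ d) : ℝ :=
  ∑ j ∈ n.support with j ≠ js ∧ j ≠ -js, kSq L j * n j

/-- Diagonal matrix elements of the Hamiltonian. -/
def diagEnergy (n : Occ d) : ℝ :=
  restEnergy L js n + (kSq L js + φ / N * n 0) * (n js + n (-js))

variable {N L φ js}

lemma creat_mul_annih_apply (j : Mode d) (ψ : Occ d → ℂ) (n : Occ d) :
    (creat j * annih j) ψ n = n j * ψ n := by
  change (√(n j) : ℂ) * ((√((n - Finsupp.single j 1 : Occ d) j + 1) : ℂ)
    * ψ (n - Finsupp.single j 1 + Finsupp.single j 1)) = _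
  by_cases h : n j = 0
  · simp [h]
  · have hsub : (((n - Finsupp.single j 1 : Occ d) j : ℕ) : ℝ) + 1 = n j := by
      exact_mod_cast (by simp; omega : (n - Finsupp.single j 1 : Occ d) j + 1 = n j)
    rw [Finsupp.sub_add_single_one_cancel h, hsub, ← mul_assoc, ← Complex.ofReal_mul,
      Real.mul_self_sqrt (Nat.cast_nonneg _), Complex.ofReal_natCast]

lemma kineticRest_apply (ψ : Occ d → ℂ) (n : Occ d) :
    kineticRest L js ψ n = restEnergy L js n * ψ n := by
  change ∑ j ∈ n.support with j ≠ js ∧ j ≠ -js, (kSq L j : ℂ) * (creat j * annih j) ψ n = _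
  simp only [creat_mul_annih_apply, restEnergy, Complex.ofReal_sum, Finset.sum_mul]
  refine Finset.sum_congr rfl fun j _ => ?_
  push_cast
  ring

lemma hZero_apply (ψ : Occ d → ℂ) (n : Occ d) :
    hZero N L φ js ψ n = ((kSq L js + φ / N * n 0) * (n js + n (-js)) : ℝ) * ψ n := by
  have hfactor (χ : Occ d → ℂ) : ((kSq L js : ℂ) • (1 : FormalOp d)
      + ((φ / N : ℝ) : ℂ) • (creat 0 * annih 0) : FormalOp d) χ n
      = (kSq L js + φ / N * n 0 : ℝ) * χ n := by
    simp only [LinearMap.add_apply, LinearMap.smul_apply, Pi.add_apply, Pi.smul_apply,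
      creat_mul_annih_apply, Module.End.one_apply, smul_eq_mul]
    push_cast
    ring
  refine (congrArg₂ (· + ·) (hfactor _) (hfactor _)).trans ?_
  rw [creat_mul_annih_apply, creat_mul_annih_apply]
  push_cast
  ring

lemma hop_eq_zero {n : Occ d} (h : n 0 < 2) : hop N φ js n = 0 := by
  obtain h | h : n 0 = 0 ∨ n 0 = 1 := by omega
  all_goals simp [hop, h]

lemma two_le_of_hop_ne_zero {n : Occ d} (h : hop N φ js n ≠ 0) : 2 ≤ n 0 :=
  not_lt.mp fun hn => h (hop_eq_zero hn)

lemma one_le_of_hopDown_ne_zero {n : Occ d} (h : hopDown N φ js n ≠ 0) :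
    1 ≤ n js ∧ 1 ≤ n (-js) := by
  constructor <;> by_contra hn <;> exact h (by simp [hopDown, Nat.lt_one_iff.mp (not_le.mp hn)])

lemma hopDown_pairUpOcc (hjs : js ≠ 0) {n : Occ d} (h : 2 ≤ n 0) :
    hopDown N φ js (pairUpOcc js n) = hop N φ js n := by
  rw [hopDown, hop, pairUpOcc_zero hjs, pairUpOcc_js hjs, pairUpOcc_neg hjs, Nat.cast_sub h]
  push_cast
  congr 2
  ring

lemma hop_sq (n : Occ d) : hop N φ js n ^ 2 =
    φ ^ 2 * ((n 0 : ℝ) * ((n 0 : ℝ) - 1) * (n js + 1) * (n (-js) + 1) / N ^ 2) := by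
  have h := natCast_mul_sub_one_nonneg (n 0)
  rw [hop, mul_pow, Real.sq_sqrt (by positivity)]
  ring

lemma hop_sq_le (c : Config d N) : hop N φ js c.1 ^ 2 ≤ φ ^ 2 * ((N : ℝ) + 1) ^ 2 := by
  have hle (j : Mode d) : (c.1 j : ℝ) ≤ N := by exact_mod_cast le_of_config c j
  have hzero : (c.1 0 : ℝ) * ((c.1 0 : ℝ) - 1) ≤ N * N := by
    nlinarith [hle 0, (c.1 0).cast_nonneg (α := ℝ)]
  calc hop N φ js c.1 ^ 2
      = φ ^ 2 * ((c.1 0 : ℝ) * ((c.1 0 : ℝ) - 1) * (c.1 js + 1) * (c.1 (-js) + 1) / N ^ 2) :=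
        hop_sq c.1
    _ ≤ φ ^ 2 * ((N : ℝ) * N * (N + 1) * (N + 1) / N ^ 2) := by
        gcongr
        exacts [le_of_config c js, le_of_config c (-js)]
    _ = φ ^ 2 * ((N : ℝ) + 1) ^ 2 * ((N : ℝ) ^ 2 / N ^ 2) := by ring
    _ ≤ φ ^ 2 * ((N : ℝ) + 1) ^ 2 := mul_le_of_le_one_right (by positivity) (div_self_le_one _)

lemma act_wFormal (hjs : js ≠ 0) (ψ : FockN d N) (c : Config d N) :
    act (wFormal N φ js) ψ c = hop N φ js c.1 * ψ (pairUp js c) := by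
  set e : Mode d → Occ d := fun k => Finsupp.single k 1 with he
  have hact : act (wFormal N φ js) ψ c = ((φ / N : ℝ) : ℂ) * ((√(c.1 0) : ℂ) *
      ((√((c.1 - e 0) 0) : ℂ) * ((√((c.1 - e 0 - e 0) js + 1) : ℂ) *
        ((√((c.1 - e 0 - e 0 + e js) (-js) + 1) : ℂ)
          * extend (fun c' => ψ c') (pairUpOcc js c.1))))) := rfl
  rw [hact]
  by_cases h : 2 ≤ c.1 0
  · have hψ : extend (fun c' => ψ c') (pairUpOcc js c.1) = ψ (pairUp js c) := by
      rw [← pairUp_val h, extend_config]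
    have hzero : (((c.1 - e 0) 0 : ℕ) : ℝ) = (c.1 0 : ℝ) - 1 := by
      rw [show (c.1 - e 0) 0 = c.1 0 - 1 by simp [he], Nat.cast_sub (by omega), Nat.cast_one]
    have hpos : (c.1 - e 0 - e 0) js = c.1 js := by simp [he, hjs.symm]
    have hneg : (c.1 - e 0 - e 0 + e js) (-js) = c.1 (-js) := by
      simp [he, (neg_ne_zero.mpr hjs).symm, self_ne_neg.mpr hjs]
    have hnonneg : (0 : ℝ) ≤ (c.1 0 : ℝ) - 1 := by
      rw [sub_nonneg]; exact_mod_cast (by omega : 1 ≤ c.1 0)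
    rw [hψ, hzero, hpos, hneg, hop, Real.sqrt_mul (by positivity), Real.sqrt_mul (by positivity),
      Real.sqrt_mul (by positivity)]
    push_cast
    ring
  · rw [hop_eq_zero (not_le.mp h)]
    obtain h0 | h0 : c.1 0 = 0 ∨ (c.1 - e 0) 0 = 0 := by simp [he]; omega
    · simp [h0]
    · rw [h0]; simp

lemma act_wStarFormal (hjs : js ≠ 0) (ψ : FockN d N) (c : Config d N) :
    act (wStarFormal N φ js) ψ c = hopDown N φ js c.1 * ψ (pairDown js c) := by
  set e : Mode d → Occ d := fun k => Finsupp.single k 1 with he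
  have hact : act (wStarFormal N φ js) ψ c = ((φ / N : ℝ) : ℂ) * ((√(c.1 0 + 1) : ℂ) *
      ((√((c.1 + e 0) 0 + 1) : ℂ) * ((√((c.1 + e 0 + e 0) js) : ℂ) *
        ((√((c.1 + e 0 + e 0 - e js) (-js)) : ℂ)
          * extend (fun c' => ψ c') (pairDownOcc js c.1))))) := rfl
  have hzero : (((c.1 + e 0) 0 : ℕ) : ℝ) + 1 = (c.1 0 : ℝ) + 2 := by
    rw [show (c.1 + e 0) 0 = c.1 0 + 1 by simp [he]]
    push_cast
    ring
  have hpos : (c.1 + e 0 + e 0) js = c.1 js := by simp [he, hjs.symm]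
  have hneg : (c.1 + e 0 + e 0 - e js) (-js) = c.1 (-js) := by
    simp [he, (neg_ne_zero.mpr hjs).symm, self_ne_neg.mpr hjs]
  rw [hact, hzero, hpos, hneg, hopDown, Real.sqrt_mul (by positivity),
    Real.sqrt_mul (by positivity), Real.sqrt_mul (by positivity)]
  by_cases h : 1 ≤ c.1 js ∧ 1 ≤ c.1 (-js)
  · have hψ : extend (fun c' => ψ c') (pairDownOcc js c.1) = ψ (pairDown js c) := by
      rw [← pairDown_val hjs h.1 h.2, extend_config]
    rw [hψ]
    push_cast
    ring
  · obtain h0 | h0 : c.1 js = 0 ∨ c.1 (-js) = 0 := by omega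
    all_goals simp [h0]

lemma W_apply (hjs : js ≠ 0) (ψ : FockN d N) (c : Config d N) :
    W N φ js ψ c = hop N φ js c.1 * ψ (pairUp js c) := by
  rw [W, boundedOp_w, act_wFormal hjs]

lemma Wst_apply (hjs : js ≠ 0) (ψ : FockN d N) (c : Config d N) :
    Wst N φ js ψ c = hopDown N φ js c.1 * ψ (pairDown js c) := by
  rw [Wst, boundedOp_wStar, act_wStarFormal hjs]

lemma act_hBogSub (hjs : js ≠ 0) (z : ℝ) (ψ : FockN d N) (c : Config d N) :
    act (hBogFormal N L φ js - (z : ℂ) • (1 : FormalOp d)) ψ c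
      = ((diagEnergy N L φ js c.1 - z : ℝ) : ℂ) * ψ c + W N φ js ψ c + Wst N φ js ψ c := by
  rw [W_apply hjs, Wst_apply hjs, ← act_wFormal hjs, ← act_wStarFormal hjs]
  simp only [act, hBogFormal, LinearMap.sub_apply, LinearMap.add_apply, LinearMap.smul_apply,
    Pi.sub_apply, Pi.add_apply, Pi.smul_apply, Module.End.one_apply, kineticRest_apply,
    hZero_apply, extend_config, diagEnergy, smul_eq_mul]
  push_cast
  ring

lemma boundedOp_cut_apply (S : Set (Occ d)) {P : Prop} [Decidable P] (ψ : FockN d N)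
    {c : Config d N} (h : c.1 ∈ S ↔ P) :
    boundedOp N (cutFormal S) ψ c = if P then ψ c else 0 := by
  rw [boundedOp_cut]
  change S.indicator 1 c.1 * extend (fun c' => ψ c') c.1 = _
  rw [extend_config]
  by_cases hP : P
  · simp [hP, h.mpr hP]
  · simp [hP, mt h.mp hP]

lemma Q_apply (i : ℕ) (ψ : FockN d N) (c : Config d N) : Q N js i ψ c =
    if pairNum js c.1 + i = N ∨ pairNum js c.1 + i + 1 = N then ψ c else 0 :=
  boundedOp_cut_apply _ ψ Iff.rfl

lemma Qgt_apply (i : ℕ) (ψ : FockN d N) (c : Config d N) : Qgt N js i ψ c =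
    if pairNum js c.1 + i + 1 < N then ψ c else 0 :=
  boundedOp_cut_apply _ ψ Iff.rfl

end MatrixElements

section Diagonal

open scoped ENNReal

variable {ι 𝕜 : Type*} [RCLike 𝕜] {p : ℝ≥0∞} {g : ι → 𝕜} {C : ℝ}

lemma memℓp_mul_of_norm_le (hg : ∀ i, ‖g i‖ ≤ C) {ψ : ι → 𝕜} (hψ : Memℓp ψ p) :
    Memℓp (fun i => g i * ψ i) p := by
  refine (hψ.const_smul (C : 𝕜)).mono' fun i => ?_
  rw [Pi.smul_apply, norm_smul, norm_mul, RCLike.norm_ofReal]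
  gcongr
  exact (hg i).trans (le_abs_self C)

lemma exists_diagonal [Fact (1 ≤ p)] (hC : 0 ≤ C) (hg : ∀ i, ‖g i‖ ≤ C) :
    ∃ B : lp (fun _ : ι => 𝕜) p →L[𝕜] lp (fun _ : ι => 𝕜) p,
      ‖B‖ ≤ C ∧ ∀ ψ i, B ψ i = g i * ψ i := by
  have hp : p ≠ 0 := (zero_lt_one.trans_le Fact.out).ne'
  let T : lp (fun _ : ι => 𝕜) p →ₗ[𝕜] lp (fun _ : ι => 𝕜) p :=
    { toFun := fun ψ => ⟨fun i => g i * ψ i, memℓp_mul_of_norm_le hg (lp.memℓp ψ)⟩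
      map_add' := fun ψ χ => by
        ext i
        exact mul_add _ _ _
      map_smul' := fun r ψ => by
        ext i
        exact mul_left_comm _ _ _ }
  refine ⟨T.mkContinuous C fun ψ => ?_, T.mkContinuous_norm_le hC _, fun ψ i => rfl⟩
  calc ‖T ψ‖ ≤ ‖(C : 𝕜) • ψ‖ := lp.norm_mono hp fun i => by
        change ‖g i * ψ i‖ ≤ ‖(C : 𝕜) * ψ i‖
        rw [norm_mul, norm_mul, RCLike.norm_ofReal, abs_of_nonneg hC]
        gcongr
        exact hg i
    _ = C * ‖ψ‖ := by rw [norm_smul, RCLike.norm_ofReal, abs_of_nonneg hC]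

lemma summable_pow_of_diagonal [Fact (1 ≤ p)]
    {A : lp (fun _ : ι => 𝕜) p →L[𝕜] lp (fun _ : ι => 𝕜) p} (hA : ∀ ψ i, A ψ i = g i * ψ i)
    (hC : 0 ≤ C) (hC1 : C < 1) (hg : ∀ i, ‖g i‖ ≤ C) :
    Summable (A ^ ·) ∧ ∀ ψ i, (∑' l : ℕ, A ^ l) ψ i = (1 - g i)⁻¹ * ψ i := by
  obtain ⟨B, hnorm, hB⟩ := exists_diagonal (p := p) hC hg
  have hAB : A = B := by
    ext ψ i
    rw [hA, hB]
  have hlt : ‖A‖ < 1 := hAB ▸ hnorm.trans_lt hC1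
  refine ⟨summable_geometric_of_norm_lt_one hlt, fun ψ i => ?_⟩
  have hne : 1 - g i ≠ 0 := sub_ne_zero.mpr fun hone => by
    have := (hg i).trans_lt hC1
    rw [← hone, norm_one] at this
    exact lt_irrefl _ this
  have hinv := congrArg (fun T : lp (fun _ : ι => 𝕜) p →L[𝕜] lp (fun _ : ι => 𝕜) p => T ψ i)
    (mul_neg_geom_series A hlt)
  change (∑' l : ℕ, A ^ l) ψ i - A ((∑' l : ℕ, A ^ l) ψ) i = ψ i at hinv
  rw [eq_inv_mul_iff_mul_eq₀ hne, ← hinv, hA, sub_mul, one_mul]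

end Diagonal

section ReducedInverse

variable {E : Type*} [NormedAddCommGroup E] [InnerProductSpace ℂ E]
  {P Pb : E →L[ℂ] E} {K : E →ₗ.[ℂ] E} {B B' : E →L[ℂ] E}

lemma IsReducedInverse.unique (h : IsReducedInverse Pb K B) (h' : IsReducedInverse Pb K B') :
    B = B' := by
  ext ψ
  obtain ⟨hdom, hK⟩ := h.2.2.1 ψ
  have hB := h.1 ψ
  have hdom' : Pb (B ψ) ∈ K.domain := by rwa [hB]
  have hKB : K ⟨Pb (B ψ), hdom'⟩ = K ⟨B ψ, hdom⟩ := congrArg K.toFun (Subtype.ext hB)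
  calc B ψ = B' (Pb (K ⟨Pb (B ψ), hdom'⟩)) := by rw [h'.2.2.2, hB]
    _ = B' ψ := by rw [hKB, hK, h'.2.1]

lemma IsReducedInverse.reducedInverse_eq (h : IsReducedInverse Pb K B) :
    reducedInverse Pb K = B := by
  have hex : BoundedInvertibleOn Pb K := ⟨B, h⟩
  rw [reducedInverse, dif_pos hex]
  exact hex.choose_spec.unique h

lemma IsReducedInverse.feshbach_apply (h : IsReducedInverse Pb K B)
    (ψ : (feshbach P Pb K).domain) :
    ∃ (χ η : E) (hη : η ∈ K.domain), χ = K ⟨P ψ, ψ.2⟩ ∧ η = B (Pb χ) ∧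
      feshbach P Pb K ψ = P χ - P (K ⟨η, hη⟩) := by
  obtain rfl := h.reducedInverse_eq
  exact ⟨_, _, reducedInverse_mem Pb K _, rfl, rfl, rfl⟩

end ReducedInverse

section SectorPivot

variable {d N : ℕ} {L φ z : ℝ} {js : Mode d}

lemma kSq_zero : kSq L (0 : Mode d) = 0 := by simp [kSq]

lemma kSq_nonneg (j : Mode d) : 0 ≤ kSq L j := Finset.sum_nonneg fun _ _ => sq_nonneg _

lemma restEnergy_nonneg (n : Occ d) : 0 ≤ restEnergy L js n :=
  Finset.sum_nonneg fun j _ => mul_nonneg (kSq_nonneg j) (Nat.cast_nonneg _)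

lemma restEnergy_eq_sum {n : Occ d} {T : Finset (Mode d)} (hT : n.support ⊆ T) :
    restEnergy L js n = ∑ j ∈ T with j ≠ js ∧ j ≠ -js, kSq L j * n j := by
  refine Finset.sum_subset (Finset.filter_subset_filter _ hT) fun j hj hj' => ?_
  have hn : n j = 0 := by
    by_contra hn
    exact hj' (Finset.mem_filter.mpr ⟨Finsupp.mem_support_iff.mpr hn, (Finset.mem_filter.mp hj).2⟩)
  simp [hn]

lemma restEnergy_pairUpOcc (n : Occ d) :
    restEnergy L js (pairUpOcc js n) = restEnergy L js n := by
  classical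
  rw [restEnergy_eq_sum (T := n.support ∪ (pairUpOcc js n).support) Finset.subset_union_right,
    restEnergy_eq_sum (T := n.support ∪ (pairUpOcc js n).support) Finset.subset_union_left]
  refine Finset.sum_congr rfl fun j hj => ?_
  obtain ⟨-, hpos, hneg⟩ := Finset.mem_filter.mp hj
  by_cases h0 : j = 0
  · simp [h0, kSq_zero]
  · rw [pairUpOcc_of_ne h0 hpos hneg]

/-- Schur complement of the Hamiltonian minus `z` at the configuration `n`, after elimination of all
configurations obtained from `n` by moving pairs from the zero mode to `± js`. -/
def sectorPivot (N : ℕ) (L φ : ℝ) (js : Mode d) (z : ℝ) (n : Occ d) : ℝ :=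
  φ * pivot N (eps L φ js) ((restEnergy L js n - z) / φ) (n 0) (n js) (n (-js))

/-- Diagonal matrix elements of `Γ`: what the elimination of the configurations above `c` subtracts
from the diagonal of the Hamiltonian. -/
def gamEntry (N : ℕ) (L φ : ℝ) (js : Mode d) (z : ℝ) (c : Config d N) : ℝ :=
  hop N φ js c.1 ^ 2 / sectorPivot N L φ js z (pairUp js c).1

lemma sectorPivot_eq (hjs : js ≠ 0) (hφ : φ ≠ 0) (c : Config d N) :
    sectorPivot N L φ js z c.1 = diagEnergy N L φ js c.1 - z - gamEntry N L φ js z c := by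
  have hdiag : φ * ((eps L φ js + (c.1 0 : ℝ) / N) * ((c.1 js : ℝ) + c.1 (-js))
      + (restEnergy L js c.1 - z) / φ) = diagEnergy N L φ js c.1 - z := by
    rw [diagEnergy, eps]; field_simp; ring
  rw [sectorPivot, pivot_eq, mul_sub, hdiag, gamEntry]
  by_cases h : 2 ≤ c.1 0
  · have hup : sectorPivot N L φ js z (pairUp js c).1 = φ * pivot N (eps L φ js)
        ((restEnergy L js c.1 - z) / φ) (c.1 0 - 2) (c.1 js + 1) (c.1 (-js) + 1) := by
      rw [sectorPivot, pairUp_val h, restEnergy_pairUpOcc, pairUpOcc_zero hjs, pairUpOcc_js hjs,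
        pairUpOcc_neg hjs]
    rw [hup, hop_sq, sq φ, mul_assoc φ φ, mul_div_mul_left _ _ hφ]
    exact congrArg _ (mul_div_assoc _ _ _).symm
  · rw [hop_eq_zero (not_le.mp h)]
    obtain h0 | h0 : c.1 0 = 0 ∨ c.1 0 = 1 := by omega
    all_goals simp [h0]

/-- The Schur complements are bounded from below on configurations with particles in `± js`. -/
def PivotsBounded (N : ℕ) (L φ : ℝ) (js : Mode d) (z δ : ℝ) : Prop :=
  0 < δ ∧ ∀ c : Config d N, 1 ≤ pairNum js c.1 → δ ≤ sectorPivot N L φ js z c.1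

variable {δ : ℝ}

lemma PivotsBounded.le_pairUp (h : PivotsBounded N L φ js z δ) (hjs : js ≠ 0) {c : Config d N}
    (hc : 2 ≤ c.1 0) : δ ≤ sectorPivot N L φ js z (pairUp js c).1 :=
  h.2 _ (by rw [pairNum_pairUp hjs hc]; omega)

lemma PivotsBounded.gamEntry_nonneg (h : PivotsBounded N L φ js z δ) (hjs : js ≠ 0)
    (c : Config d N) : 0 ≤ gamEntry N L φ js z c := by
  rw [gamEntry]
  by_cases hc : 2 ≤ c.1 0
  · exact div_nonneg (sq_nonneg _) (h.1.le.trans (h.le_pairUp hjs hc))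
  · simp [hop_eq_zero (not_le.mp hc)]

lemma PivotsBounded.gamEntry_le (h : PivotsBounded N L φ js z δ) (hjs : js ≠ 0)
    (c : Config d N) : gamEntry N L φ js z c ≤ φ ^ 2 * ((N : ℝ) + 1) ^ 2 / δ := by
  have hδ := h.1
  rw [gamEntry]
  by_cases hc : 2 ≤ c.1 0
  · exact div_le_div₀ (by positivity) (hop_sq_le c) hδ (h.le_pairUp hjs hc)
  · rw [hop_eq_zero (not_le.mp hc), zero_pow two_ne_zero, zero_div]
    positivity

end SectorPivot

section Tridiagonal

variable {d N : ℕ} {L φ z δ C : ℝ} {js : Mode d} {t u : ℕ} {g : Config d N → ℝ}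
  {K : FockN d N →ₗ.[ℂ] FockN d N}

variable (N φ js) in
/-- The part `W + W^*` of the Hamiltonian, acting on arbitrary coefficient families. -/
def pairHop (ψ : Config d N → ℂ) (c : Config d N) : ℂ :=
  hop N φ js c.1 * ψ (pairUp js c) + hopDown N φ js c.1 * ψ (pairDown js c)

/-- `c` lies in the range of `Q^{(2t, 2t+1)}`. -/
def InShell (N : ℕ) (js : Mode d) (t : ℕ) (c : Config d N) : Prop :=
  pairNum js c.1 + 2 * t = N ∨ pairNum js c.1 + 2 * t + 1 = N

instance (t : ℕ) (c : Config d N) : Decidable (InShell N js t c) :=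
  inferInstanceAs (Decidable (_ ∨ _))

/-- `K` is the restriction of `H - z` to configurations with at most `N - 2t` particles in `± js`,
with diagonal entries replaced by `g`. -/
structure IsTridiag (N : ℕ) (L φ : ℝ) (js : Mode d) (z : ℝ) (t : ℕ) (g : Config d N → ℝ)
    (K : FockN d N →ₗ.[ℂ] FockN d N) : Prop where
  mem_domain (ψ : FockN d N) : ψ ∈ K.domain ↔ Memℓp (fun c : Config d N =>
    if pairNum js c.1 + 2 * t ≤ N then ((diagEnergy N L φ js c.1 - z : ℝ) : ℂ) * ψ c else 0) 2
  apply_eq {ψ : FockN d N} (hψ : ψ ∈ K.domain)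
    (hsupp : ∀ c : Config d N, ¬ pairNum js c.1 + 2 * t ≤ N → ψ c = 0) (c : Config d N) :
    K ⟨ψ, hψ⟩ c =
      if pairNum js c.1 + 2 * t ≤ N then (g c : ℂ) * ψ c + pairHop N φ js ψ c else 0

lemma isTridiag_hBogSub (hjs : js ≠ 0) :
    IsTridiag N L φ js z 0 (fun c => diagEnergy N L φ js c.1 - z) (hBogSub N L φ js z) where
  mem_domain ψ := by
    simp only [mul_zero, add_zero, pairNum_le hjs, if_true]
    have hact : act (hBogFormal N L φ js - (z : ℂ) • (1 : FormalOp d)) ψ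
        = (fun c : Config d N => ((diagEnergy N L φ js c.1 - z : ℝ) : ℂ) * ψ c)
          + ⇑(W N φ js ψ + Wst N φ js ψ) := by
      ext c
      rw [act_hBogSub hjs, Pi.add_apply, lp.coeFn_add, Pi.add_apply, add_assoc]
    change Memℓp (act _ ψ) 2 ↔ _
    rw [hact]
    refine ⟨fun h => ?_, fun h => h.add (lp.memℓp _)⟩
    simpa only [add_sub_cancel_right] using h.sub (lp.memℓp (W N φ js ψ + Wst N φ js ψ))
  apply_eq {ψ} _ _ c := by
    simp only [mul_zero, add_zero, pairNum_le hjs, if_true]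
    change act _ ψ c = _
    rw [act_hBogSub hjs, W_apply hjs, Wst_apply hjs, pairHop, add_assoc]

lemma InShell.le {c : Config d N} (h : InShell N js u c) (htu : t ≤ u) :
    pairNum js c.1 + 2 * t ≤ N := by
  rcases h with h | h <;> omega

lemma InShell.not_le {c : Config d N} (h : InShell N js u c) (htu : u < t) :
    ¬ pairNum js c.1 + 2 * t ≤ N := by
  rcases h with h | h <;> omega

lemma InShell.one_le {c : Config d N} (h : InShell N js t c) (ht : t < N / 2) :
    1 ≤ pairNum js c.1 := by
  rcases h with h | h <;> omega

lemma pairNum_pairUp_of_hop (hjs : js ≠ 0) {c : Config d N} (hc : hop N φ js c.1 ≠ 0) :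
    pairNum js (pairUp js c).1 = pairNum js c.1 + 2 :=
  pairNum_pairUp hjs (two_le_of_hop_ne_zero hc)

lemma pairNum_pairDown_of_hopDown (hjs : js ≠ 0) {c : Config d N}
    (hc : hopDown N φ js c.1 ≠ 0) : pairNum js (pairDown js c).1 + 2 = pairNum js c.1 :=
  pairNum_pairDown hjs (one_le_of_hopDown_ne_zero hc).1 (one_le_of_hopDown_ne_zero hc).2

lemma hopDown_pairUp (hjs : js ≠ 0) {c : Config d N} (hc : hop N φ js c.1 ≠ 0) :
    hopDown N φ js (pairUp js c).1 = hop N φ js c.1 := by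
  rw [pairUp_val (two_le_of_hop_ne_zero hc), hopDown_pairUpOcc hjs (two_le_of_hop_ne_zero hc)]

lemma InShell.pairUp_iff (hjs : js ≠ 0) {c : Config d N} (hc : hop N φ js c.1 ≠ 0) :
    InShell N js t (pairUp js c) ↔ InShell N js (t + 1) c := by
  rw [InShell, InShell, pairNum_pairUp_of_hop hjs hc]
  omega

lemma pairHop_of_le (hjs : js ≠ 0) {ψ : Config d N → ℂ} (hψ : ∀ c, ¬ InShell N js t c → ψ c = 0)
    {c : Config d N} (hc : pairNum js c.1 + 2 * t ≤ N) :
    pairHop N φ js ψ c = hop N φ js c.1 * ψ (pairUp js c) := by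
  rw [pairHop, add_eq_left, mul_eq_zero, or_iff_not_imp_left]
  intro hdown
  have hnum := pairNum_pairDown_of_hopDown hjs (Complex.ofReal_ne_zero.mp hdown)
  exact hψ _ (by rintro (hs | hs) <;> omega)

lemma pairHop_of_inShell (hjs : js ≠ 0) {ψ : Config d N → ℂ}
    (hψ : ∀ c, ¬ pairNum js c.1 + 2 * t ≤ N → ψ c = 0) {c : Config d N} (hc : InShell N js t c) :
    pairHop N φ js ψ c = hopDown N φ js c.1 * ψ (pairDown js c) := by
  rw [pairHop, add_eq_right, mul_eq_zero, or_iff_not_imp_left]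
  intro hup
  refine hψ _ ?_
  rw [pairNum_pairUp_of_hop hjs (Complex.ofReal_ne_zero.mp hup)]
  rcases hc with hc | hc <;> omega

lemma pairHop_eq_zero_of_inShell (hjs : js ≠ 0) {ψ : Config d N → ℂ}
    (hψ : ∀ c, ¬ InShell N js t c → ψ c = 0) {c : Config d N} (hc : InShell N js t c) :
    pairHop N φ js ψ c = 0 := by
  rw [pairHop_of_le hjs hψ (hc.le le_rfl), mul_eq_zero, or_iff_not_imp_left]
  intro hup
  refine hψ _ fun hs => hc.not_le (Nat.lt_succ_self t) ?_
  exact ((InShell.pairUp_iff hjs (Complex.ofReal_ne_zero.mp hup)).mp hs).le le_rfl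

lemma IsTridiag.apply_of_inShell (hK : IsTridiag N L φ js z t g K) (hjs : js ≠ 0) (htu : t ≤ u)
    {ψ : FockN d N} (hψ : ψ ∈ K.domain) (hsupp : ∀ c, ¬ InShell N js u c → ψ c = 0)
    {c : Config d N} (hc : InShell N js u c) : K ⟨ψ, hψ⟩ c = g c * ψ c := by
  rw [hK.apply_eq hψ (fun c hc => hsupp c fun hs => hc (hs.le htu)), if_pos (hc.le htu),
    pairHop_eq_zero_of_inShell hjs hsupp hc, add_zero]

/-- The inverse of the diagonal matrix `g` on the configurations satisfying `S`, extended by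
zero. -/
def maskedInv (S : Config d N → Prop) [DecidablePred S] (g : Config d N → ℝ) (c : Config d N) : ℂ :=
  if S c then (g c : ℂ)⁻¹ else 0

section MaskedInv

variable {S : Config d N → Prop} [DecidablePred S]

lemma norm_maskedInv_le (hδ : 0 < δ) (hg : ∀ c, S c → δ ≤ g c) (c : Config d N) :
    ‖maskedInv S g c‖ ≤ δ⁻¹ := by
  rw [maskedInv]
  split_ifs with hc
  · rw [norm_inv, Complex.norm_real, Real.norm_eq_abs]
    exact inv_anti₀ hδ ((hg c hc).trans (le_abs_self _))
  · simpa using hδ.le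

lemma IsTridiag.mem_domain_of_maskedInv (hK : IsTridiag N L φ js z t g K)
    (hδ : 0 < δ) (hg : ∀ c, S c → δ ≤ g c)
    (hC : ∀ c, S c → |diagEnergy N L φ js c.1 - z - g c| ≤ C)
    {ψ χ : FockN d N} (hψ : ∀ c, ψ c = maskedInv S g c * χ c) : ψ ∈ K.domain := by
  have hbound (c : Config d N) :
      ‖((diagEnergy N L φ js c.1 - z : ℝ) : ℂ) * maskedInv S g c‖ ≤ 1 + |C| * δ⁻¹ := by
    by_cases hc : S c
    · have hpos : 0 < g c := hδ.trans_le (hg c hc)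
      have hsum : diagEnergy N L φ js c.1 - z = g c + (diagEnergy N L φ js c.1 - z - g c) := by
        ring
      rw [hsum, Complex.ofReal_add, add_mul]
      refine (norm_add_le _ _).trans (add_le_add ?_ ?_)
      · rw [maskedInv, if_pos hc, mul_inv_cancel₀ (Complex.ofReal_ne_zero.mpr hpos.ne'), norm_one]
      · rw [norm_mul, Complex.norm_real, Real.norm_eq_abs]
        exact mul_le_mul ((hC c hc).trans (le_abs_self C)) (norm_maskedInv_le hδ hg c)
          (norm_nonneg _) (abs_nonneg C)
    · rw [maskedInv, if_neg hc, mul_zero, norm_zero]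
      positivity
  refine (hK.mem_domain ψ).mpr ((memℓp_mul_of_norm_le hbound (lp.memℓp χ)).mono' fun c => ?_)
  split_ifs
  · rw [hψ, mul_assoc]
  · rw [norm_zero]
    exact norm_nonneg _

lemma IsTridiag.exists_isReducedInverse (hK : IsTridiag N L φ js z t g K) (hjs : js ≠ 0)
    (htu : t ≤ u) (hS : ∀ c, S c → InShell N js u c) {P : FockN d N →L[ℂ] FockN d N}
    (hP : ∀ ψ c, P ψ c = if S c then ψ c else 0) (hδ : 0 < δ) (hg : ∀ c, S c → δ ≤ g c)
    (hC : ∀ c, S c → |diagEnergy N L φ js c.1 - z - g c| ≤ C) :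
    ∃ B : FockN d N →L[ℂ] FockN d N, (∀ ψ c, B ψ c = maskedInv S g c * ψ c) ∧
      IsReducedInverse P K B := by
  obtain ⟨B, -, hB⟩ := exists_diagonal (p := 2) (inv_nonneg.mpr hδ.le) (norm_maskedInv_le hδ hg)
  have hg0 (c : Config d N) (hc : S c) : (g c : ℂ) ≠ 0 :=
    Complex.ofReal_ne_zero.mpr (hδ.trans_le (hg c hc)).ne'
  have hPB (ψ : FockN d N) : P (B ψ) = B ψ := by
    ext c
    rw [hP, hB, maskedInv]
    split_ifs <;> simp
  have hBP (ψ : FockN d N) : B (P ψ) = B ψ := by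
    ext c
    rw [hB, hP, hB, maskedInv]
    split_ifs <;> simp
  have hB_supp (ψ : FockN d N) (c : Config d N) (hc : ¬ InShell N js u c) : B ψ c = 0 := by
    rw [hB, maskedInv, if_neg (mt (hS c) hc), zero_mul]
  have hP_supp (ψ : FockN d N) (c : Config d N) (hc : ¬ InShell N js u c) : P ψ c = 0 := by
    rw [hP, if_neg (mt (hS c) hc)]
  refine ⟨B, hB, hPB, hBP, fun ψ => ?_, fun ψ hψ => ?_⟩
  · have hdom : B ψ ∈ K.domain := hK.mem_domain_of_maskedInv hδ hg hC (hB ψ)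
    refine ⟨hdom, ?_⟩
    ext c
    rw [hP, hP]
    split_ifs with hc
    · rw [hK.apply_of_inShell hjs htu hdom (hB_supp ψ) (hS c hc), hB, maskedInv, if_pos hc,
        mul_inv_cancel_left₀ (hg0 c hc)]
    · rfl
  · ext c
    rw [hBP, hB, maskedInv, hP]
    split_ifs with hc
    · rw [hK.apply_of_inShell hjs htu hψ (hP_supp ψ) (hS c hc), hP, if_pos hc,
        inv_mul_cancel_left₀ (hg0 c hc)]
    · rw [zero_mul]

end MaskedInv

lemma Q_two_mul_apply (t : ℕ) (ψ : FockN d N) (c : Config d N) :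
    Q N js (2 * t) ψ c = if InShell N js t c then ψ c else 0 := Q_apply _ ψ c

/-- Diagonal entries of the Feshbach–Schur flow. -/
def flowDiag (N : ℕ) (L φ : ℝ) (js : Mode d) (z : ℝ) (t : ℕ) (c : Config d N) : ℝ :=
  if InShell N js t c then sectorPivot N L φ js z c.1 else diagEnergy N L φ js c.1 - z

lemma gamEntry_eq_zero {c : Config d N} (hc : hop N φ js c.1 = 0) :
    gamEntry N L φ js z c = 0 := by
  rw [gamEntry, hc, zero_pow two_ne_zero, zero_div]

lemma gamEntry_eq_zero_of_inShell_zero (hjs : js ≠ 0) {c : Config d N} (hc : InShell N js 0 c) :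
    gamEntry N L φ js z c = 0 := by
  have hle := occ_add_pairNum_le hjs c
  refine gamEntry_eq_zero (hop_eq_zero ?_)
  rw [InShell, pairNum] at hc
  omega

lemma flowDiag_zero (hjs : js ≠ 0) (hφ : φ ≠ 0) :
    flowDiag N L φ js z 0 = fun c : Config d N => diagEnergy N L φ js c.1 - z := by
  funext c
  rw [flowDiag]
  split_ifs with hc
  · rw [sectorPivot_eq hjs hφ, gamEntry_eq_zero_of_inShell_zero hjs hc, sub_zero]
  · rfl

lemma flowDiag_succ (hjs : js ≠ 0) (hφ : φ ≠ 0) {c : Config d N}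
    (hc : pairNum js c.1 + 2 * (t + 1) ≤ N) :
    flowDiag N L φ js z (t + 1) c = flowDiag N L φ js z t c
      - if InShell N js t (pairUp js c) then gamEntry N L φ js z c else 0 := by
  have hshell : ¬ InShell N js t c := fun hs => hs.not_le (Nat.lt_succ_self t) hc
  rw [flowDiag, flowDiag, if_neg hshell, sectorPivot_eq hjs hφ]
  by_cases hhop : hop N φ js c.1 = 0
  · simp [gamEntry_eq_zero hhop]
  · simp only [InShell.pairUp_iff hjs hhop]
    split_ifs
    · rfl
    · rw [sub_zero]

lemma Qgt_two_mul_apply (t : ℕ) (ψ : FockN d N) (c : Config d N) : Qgt N js (2 * t) ψ c =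
    if pairNum js c.1 + 2 * (t + 1) ≤ N then ψ c else 0 := by
  rw [Qgt_apply]
  exact if_congr (by omega) rfl rfl

lemma PivotsBounded.isReducedInverse_hBogSub (h : PivotsBounded N L φ js z δ) (hjs : js ≠ 0)
    (hφ : φ ≠ 0) (ht : t < N / 2) :
    ∃ B : FockN d N →L[ℂ] FockN d N,
      (∀ ψ c, B ψ c = maskedInv (InShell N js t) (fun c => diagEnergy N L φ js c.1 - z) c * ψ c) ∧
      IsReducedInverse (Q N js (2 * t)) (hBogSub N L φ js z) B := by
  refine (isTridiag_hBogSub hjs).exists_isReducedInverse (C := 0) hjs (Nat.zero_le t)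
    (fun _ hc => hc) (Q_two_mul_apply t) h.1 (fun c hc => ?_)
    (fun c _ => by rw [sub_self, abs_zero])
  have hpivot := h.2 c (hc.one_le ht)
  rw [sectorPivot_eq hjs hφ] at hpivot
  exact hpivot.trans (sub_le_self _ (h.gamEntry_nonneg hjs c))

lemma PivotsBounded.isReducedInverse_of_isTridiag (h : PivotsBounded N L φ js z δ) (hjs : js ≠ 0)
    (hφ : φ ≠ 0) (hK : IsTridiag N L φ js z t (flowDiag N L φ js z t) K)
    {S : Config d N → Prop} [DecidablePred S] (hS : ∀ c, S c → InShell N js t c)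
    {P : FockN d N →L[ℂ] FockN d N} (hP : ∀ ψ c, P ψ c = if S c then ψ c else 0) {δ' : ℝ}
    (hδ' : 0 < δ') (hpivot : ∀ c, S c → δ' ≤ sectorPivot N L φ js z c.1) :
    ∃ B : FockN d N →L[ℂ] FockN d N,
      (∀ ψ c, B ψ c = maskedInv S (fun c => sectorPivot N L φ js z c.1) c * ψ c) ∧
      IsReducedInverse P K B := by
  have hflow (c : Config d N) (hc : S c) :
      flowDiag N L φ js z t c = sectorPivot N L φ js z c.1 := if_pos (hS c hc)
  have hgap (c : Config d N) (hc : S c) :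
      |diagEnergy N L φ js c.1 - z - flowDiag N L φ js z t c|
        ≤ φ ^ 2 * ((N : ℝ) + 1) ^ 2 / δ := by
    rw [hflow c hc, sectorPivot_eq hjs hφ, sub_sub_cancel, abs_of_nonneg (h.gamEntry_nonneg hjs c)]
    exact h.gamEntry_le hjs c
  obtain ⟨B, hB, hinv⟩ := hK.exists_isReducedInverse hjs le_rfl hS hP hδ'
    (fun c hc => (hpivot c hc).trans_eq (hflow c hc).symm) hgap
  refine ⟨B, fun ψ c => ?_, hinv⟩
  rw [hB, maskedInv, maskedInv]
  split_ifs with hc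
  · rw [hflow c hc]
  · rfl

lemma pairHop_maskedInv (hjs : js ≠ 0) {ψ χ ξ : Config d N → ℂ}
    (hψ : ∀ c, ¬ pairNum js c.1 + 2 * (t + 1) ≤ N → ψ c = 0)
    (hχ : ∀ c, InShell N js t c → χ c = pairHop N φ js ψ c)
    (hξ : ∀ c, ξ c = maskedInv (InShell N js t) (fun c => sectorPivot N L φ js z c.1) c * χ c)
    {c : Config d N} (hc : pairNum js c.1 + 2 * (t + 1) ≤ N) :
    pairHop N φ js ξ c =
      ((if InShell N js t (pairUp js c) then gamEntry N L φ js z c else 0 : ℝ) : ℂ) * ψ c := by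
  rw [pairHop_of_le (t := t) hjs (fun c hc => by rw [hξ, maskedInv, if_neg hc, zero_mul])
    (by omega), hξ, maskedInv]
  by_cases hhop : hop N φ js c.1 = 0
  · simp [hhop, gamEntry_eq_zero hhop]
  split_ifs with hs
  · rw [hχ _ hs, pairHop_of_inShell hjs (fun c hc => hψ c fun hle => hc (by omega)) hs,
      pairDown_pairUp hjs (two_le_of_hop_ne_zero hhop), hopDown_pairUp hjs hhop, gamEntry]
    push_cast
    ring
  · simp

lemma IsTridiag.mem_domain_feshbach {f : Config d N → ℝ} (hK : IsTridiag N L φ js z t f K)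
    {Pb : FockN d N →L[ℂ] FockN d N} (ψ : FockN d N) :
    ψ ∈ (feshbach (Qgt N js (2 * t)) Pb K).domain ↔ Memℓp (fun c : Config d N =>
      if pairNum js c.1 + 2 * (t + 1) ≤ N then
        ((diagEnergy N L φ js c.1 - z : ℝ) : ℂ) * ψ c else 0) 2 := by
  change Qgt N js (2 * t) ψ ∈ K.domain ↔ _
  rw [hK.mem_domain]
  refine iff_of_eq (congrArg (Memℓp · 2) (funext fun c => ?_))
  rw [Qgt_two_mul_apply]
  by_cases hc : pairNum js c.1 + 2 * (t + 1) ≤ N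
  · rw [if_pos hc, if_pos hc, if_pos (by omega)]
  · simp [hc]

lemma PivotsBounded.isTridiag_feshbach (h : PivotsBounded N L φ js z δ) (hjs : js ≠ 0)
    (hφ : φ ≠ 0) (ht : t < N / 2) (hK : IsTridiag N L φ js z t (flowDiag N L φ js z t) K) :
    IsTridiag N L φ js z (t + 1) (flowDiag N L φ js z (t + 1))
      (feshbach (Qgt N js (2 * t)) (Q N js (2 * t)) K) := by
  obtain ⟨B, hB, hinv⟩ := h.isReducedInverse_of_isTridiag hjs hφ hK (fun _ hc => hc)
    (Q_two_mul_apply t) h.1 (fun c hc => h.2 c (hc.one_le ht))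
  refine ⟨fun ψ => hK.mem_domain_feshbach ψ, fun {ψ} hψ hsupp c => ?_⟩
  obtain ⟨χ, ξ, hξ, hχ, hξχ, hfesh⟩ := hinv.feshbach_apply (P := Qgt N js (2 * t)) ⟨ψ, hψ⟩
  have hPψ : Qgt N js (2 * t) ψ = ψ := by
    ext c
    rw [Qgt_two_mul_apply]
    split_ifs with hc
    exacts [rfl, (hsupp c hc).symm]
  have hψdom : ψ ∈ K.domain := hPψ ▸ hψ
  have hKψ : χ = K ⟨ψ, hψdom⟩ := hχ.trans (congrArg K.toFun (Subtype.ext hPψ))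
  have hsupp' (c : Config d N) (hc : ¬ pairNum js c.1 + 2 * t ≤ N) : ψ c = 0 :=
    hsupp c fun hle => hc (by omega)
  have hχ_apply (c : Config d N) (hc : pairNum js c.1 + 2 * t ≤ N) :
      χ c = flowDiag N L φ js z t c * ψ c + pairHop N φ js ψ c := by
    rw [hKψ, hK.apply_eq hψdom hsupp', if_pos hc]
  have hχ_shell (c : Config d N) (hs : InShell N js t c) : χ c = pairHop N φ js ψ c := by
    rw [hχ_apply c (hs.le le_rfl), hsupp c (hs.not_le (Nat.lt_succ_self t)), mul_zero, zero_add]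
  have hξ_apply (c : Config d N) :
      ξ c = maskedInv (InShell N js t) (fun c => sectorPivot N L φ js z c.1) c * χ c := by
    rw [hξχ, hinv.2.1, hB]
  have hξ_supp (c : Config d N) (hc : ¬ InShell N js t c) : ξ c = 0 := by
    rw [hξ_apply, maskedInv, if_neg hc, zero_mul]
  rw [hfesh, lp.coeFn_sub, Pi.sub_apply, Qgt_two_mul_apply, Qgt_two_mul_apply]
  split_ifs with hc
  · rw [hχ_apply c (by omega), hK.apply_eq hξ (fun c hc => hξ_supp c fun hs => hc (hs.le le_rfl)),
      if_pos (by omega), hξ_supp c (fun hs => hs.not_le (Nat.lt_succ_self t) hc), mul_zero,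
      zero_add, pairHop_maskedInv hjs hsupp hχ_shell hξ_apply hc, flowDiag_succ hjs hφ hc]
    push_cast
    ring
  · rw [sub_zero]

lemma PivotsBounded.isTridiag_flow (h : PivotsBounded N L φ js z δ) (hjs : js ≠ 0) (hφ : φ ≠ 0)
    (ht : t ≤ N / 2) : IsTridiag N L φ js z t (flowDiag N L φ js z t) (flow N L φ js z t) := by
  induction t with
  | zero =>
    rw [flowDiag_zero hjs hφ]
    exact isTridiag_hBogSub hjs
  | succ t ih => exact h.isTridiag_feshbach hjs hφ (by omega) (ih (by omega))

end Tridiagonal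

section Gamma

variable {d N : ℕ} {L φ z δ : ℝ} {js : Mode d} {t : ℕ}

lemma PivotsBounded.R_apply (h : PivotsBounded N L φ js z δ) (hjs : js ≠ 0) (hφ : φ ≠ 0)
    (ht : t < N / 2) (ψ : FockN d N) (c : Config d N) : R N L φ js z (2 * t) ψ c =
      maskedInv (InShell N js t) (fun c => diagEnergy N L φ js c.1 - z) c * ψ c := by
  obtain ⟨B, hB, hinv⟩ := h.isReducedInverse_hBogSub hjs hφ ht
  rw [R, hinv.reducedInverse_eq, hB]

/-- Diagonal entries of `Γ_{2t,2t}(z) R_{2t,2t}(z)`, the ratio of the Neumann series. -/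
def neumannRatio (N : ℕ) (L φ : ℝ) (js : Mode d) (z : ℝ) (t : ℕ) (c : Config d N) : ℝ :=
  if InShell N js t c then gamEntry N L φ js z c / (diagEnergy N L φ js c.1 - z) else 0

lemma diagEnergy_sub_eq_gamEntry_add (hjs : js ≠ 0) (hφ : φ ≠ 0) (c : Config d N) :
    diagEnergy N L φ js c.1 - z = gamEntry N L φ js z c + sectorPivot N L φ js z c.1 := by
  rw [sectorPivot_eq hjs hφ]
  ring

lemma div_add_le_div_add {a b p q : ℝ} (ha : 0 ≤ a) (hab : a ≤ b) (hp : 0 < p) (hpq : p ≤ q) :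
    a / (a + q) ≤ b / (b + p) := by
  rw [div_le_div_iff₀ (by linarith) (by linarith)]
  linarith [mul_le_mul hab hpq hp.le (ha.trans hab)]

lemma PivotsBounded.norm_neumannRatio_le (h : PivotsBounded N L φ js z δ) (hjs : js ≠ 0)
    (hφ : φ ≠ 0) (ht : t < N / 2) (c : Config d N) :
    ‖(neumannRatio N L φ js z t c : ℂ)‖ ≤
      φ ^ 2 * ((N : ℝ) + 1) ^ 2 / δ / (φ ^ 2 * ((N : ℝ) + 1) ^ 2 / δ + δ) := by
  have hδ := h.1
  rw [neumannRatio, Complex.norm_real]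
  split_ifs with hc
  · have hnonneg := h.gamEntry_nonneg hjs c
    have hpivot := h.2 c (hc.one_le ht)
    have hpos := hδ.trans_le hpivot
    rw [diagEnergy_sub_eq_gamEntry_add hjs hφ, Real.norm_eq_abs, abs_of_nonneg (by positivity)]
    exact div_add_le_div_add hnonneg (h.gamEntry_le hjs c) hδ hpivot
  · rw [norm_zero]
    positivity

lemma PivotsBounded.maskedInv_mul_inv_one_sub_neumannRatio (h : PivotsBounded N L φ js z δ)
    (hjs : js ≠ 0) (hφ : φ ≠ 0) (ht : t < N / 2) (c : Config d N) :
    maskedInv (InShell N js t) (fun c => diagEnergy N L φ js c.1 - z) c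
        * (1 - (neumannRatio N L φ js z t c : ℂ))⁻¹
      = maskedInv (InShell N js t) (fun c => sectorPivot N L φ js z c.1) c := by
  rw [maskedInv, maskedInv, neumannRatio]
  split_ifs with hc
  · have hpos := h.1.trans_le (h.2 c (hc.one_le ht))
    have hne : gamEntry N L φ js z c + sectorPivot N L φ js z c.1 ≠ 0 :=
      (add_pos_of_nonneg_of_pos (h.gamEntry_nonneg hjs c) hpos).ne'
    rw [diagEnergy_sub_eq_gamEntry_add hjs hφ, ← Complex.ofReal_one, ← Complex.ofReal_sub,
      one_sub_div hne, add_sub_cancel_left, ← Complex.ofReal_inv, ← Complex.ofReal_inv,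
      ← Complex.ofReal_mul, ← Complex.ofReal_inv, inv_div, inv_mul_eq_div, div_right_comm,
      div_self hne, one_div]
  · rw [zero_mul]

lemma PivotsBounded.neumann (h : PivotsBounded N L φ js z δ) (hjs : js ≠ 0) (hφ : φ ≠ 0)
    (ht : t < N / 2) (hG : ∀ ψ (c : Config d N), Gam N L φ js z t ψ c
      = (if InShell N js t c then (gamEntry N L φ js z c : ℂ) else 0) * ψ c) :
    (Summable fun l : ℕ => (Gam N L φ js z t * R N L φ js z (2 * t)) ^ l) ∧
    ∀ ψ c, R N L φ js z (2 * t) ((∑' l : ℕ, (Gam N L φ js z t * R N L φ js z (2 * t)) ^ l) ψ) c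
      = maskedInv (InShell N js t) (fun c => sectorPivot N L φ js z c.1) c * ψ c := by
  have hδ := h.1
  have hGR (ψ : FockN d N) (c : Config d N) :
      (Gam N L φ js z t * R N L φ js z (2 * t)) ψ c = neumannRatio N L φ js z t c * ψ c := by
    change Gam N L φ js z t (R N L φ js z (2 * t) ψ) c = _
    rw [hG, h.R_apply hjs hφ ht, maskedInv, neumannRatio]
    split_ifs
    · rw [Complex.ofReal_div, ← mul_assoc, div_eq_mul_inv]
    · rw [zero_mul, Complex.ofReal_zero, zero_mul]
  have hlt : φ ^ 2 * ((N : ℝ) + 1) ^ 2 / δ / (φ ^ 2 * ((N : ℝ) + 1) ^ 2 / δ + δ) < 1 :=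
    (div_lt_one (by positivity)).mpr (lt_add_of_pos_right _ hδ)
  obtain ⟨hsummable, htsum⟩ := summable_pow_of_diagonal hGR (by positivity) hlt
    (h.norm_neumannRatio_le hjs hφ ht)
  refine ⟨hsummable, fun ψ c => ?_⟩
  rw [h.R_apply hjs hφ ht, htsum, ← mul_assoc,
    h.maskedInv_mul_inv_one_sub_neumannRatio hjs hφ ht]

lemma PivotsBounded.Gam_apply (h : PivotsBounded N L φ js z δ) (hjs : js ≠ 0) (hφ : φ ≠ 0)
    (ht : t < N / 2) (ψ : FockN d N) (c : Config d N) : Gam N L φ js z t ψ c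
      = (if InShell N js t c then (gamEntry N L φ js z c : ℂ) else 0) * ψ c := by
  induction t generalizing ψ c with
  | zero =>
    have hzero : Gam N L φ js z 0 ψ c = 0 := rfl
    rw [hzero, eq_comm, mul_eq_zero]
    left
    split_ifs with hc
    · rw [gamEntry_eq_zero_of_inShell_zero hjs hc, Complex.ofReal_zero]
    · rfl
  | succ t ih =>
    obtain ⟨-, hRS⟩ := h.neumann hjs hφ (by omega) (ih (by omega))
    set S := ∑' l : ℕ, (Gam N L φ js z t * R N L φ js z (2 * t)) ^ l
    have hunfold : Gam N L φ js z (t + 1) ψ c = Q N js (2 * (t + 1)) (W N φ js (Q N js (2 * t)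
        (R N L φ js z (2 * t) (S (Q N js (2 * t) (Wst N φ js
          (Q N js (2 * (t + 1)) ψ))))))) c := rfl
    rw [hunfold, Q_two_mul_apply]
    split_ifs with hc
    · rw [W_apply hjs]
      by_cases hhop : hop N φ js c.1 = 0
      · simp [hhop, gamEntry_eq_zero hhop]
      · have hs := (InShell.pairUp_iff (t := t) hjs hhop).mpr hc
        rw [Q_two_mul_apply, if_pos hs, hRS, maskedInv, if_pos hs, Q_two_mul_apply, if_pos hs,
          Wst_apply hjs, pairDown_pairUp hjs (two_le_of_hop_ne_zero hhop), Q_two_mul_apply,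
          if_pos hc, hopDown_pairUp hjs hhop, gamEntry]
        push_cast
        ring
    · rw [zero_mul]

lemma PivotsBounded.flowWellDefined (h : PivotsBounded N L φ js z δ) (hjs : js ≠ 0)
    (hφ : φ ≠ 0) : FlowWellDefined N L φ js z := by
  intro t ht
  obtain ⟨B, -, hB⟩ := h.isReducedInverse_of_isTridiag hjs hφ (h.isTridiag_flow hjs hφ ht.le)
    (fun _ hc => hc) (Q_two_mul_apply t) h.1 (fun c hc => h.2 c (hc.one_le ht))
  obtain ⟨B', -, hB'⟩ := h.isReducedInverse_hBogSub hjs hφ ht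
  exact ⟨⟨B, hB⟩, ⟨B', hB'⟩, (h.neumann hjs hφ ht (h.Gam_apply hjs hφ ht)).1⟩

end Gamma

section Eta

variable {d N : ℕ} {L φ z δ δ' : ℝ} {js : Mode d}

/-- The configuration with all particles in the zero mode, the support of `η`. -/
def etaConfig (d N : ℕ) : Config d N := ⟨Finsupp.single 0 N, by simp⟩

lemma eta_apply_self : eta d N (etaConfig d N) = 1 := lp.single_apply_self 2 _ _

lemma eta_apply_of_ne {c : Config d N} (hc : c ≠ etaConfig d N) : eta d N c = 0 :=
  lp.single_apply_ne 2 _ _ hc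

lemma inner_eta (ψ : FockN d N) : ⟪eta d N, ψ⟫_ℂ = ψ (etaConfig d N) :=
  (lp.inner_single_left _ _ _).trans (RCLike.inner_apply 1 _ |>.trans (by simp; rfl))

lemma Peta_apply_self (ψ : FockN d N) :
    Peta d N ψ (etaConfig d N) = ψ (etaConfig d N) := by
  rw [Peta, InnerProductSpace.rankOne_apply, inner_eta, lp.coeFn_smul, Pi.smul_apply,
    eta_apply_self, smul_eq_mul, mul_one]

lemma Peta_apply_of_ne (ψ : FockN d N) {c : Config d N} (hc : c ≠ etaConfig d N) :
    Peta d N ψ c = 0 := by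
  rw [Peta, InnerProductSpace.rankOne_apply, lp.coeFn_smul, Pi.smul_apply,
    eta_apply_of_ne hc, smul_zero]

lemma etaConfig_apply_zero : (etaConfig d N).1 0 = N := Finsupp.single_eq_same

lemma etaConfig_apply_of_ne {j : Mode d} (hj : j ≠ 0) : (etaConfig d N).1 j = 0 :=
  Finsupp.single_eq_of_ne hj

lemma pairNum_etaConfig (hjs : js ≠ 0) : pairNum js (etaConfig d N).1 = 0 := by
  rw [pairNum, etaConfig_apply_of_ne hjs, etaConfig_apply_of_ne (neg_ne_zero.mpr hjs)]

lemma restEnergy_etaConfig : restEnergy L js (etaConfig d N).1 = 0 := by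
  refine Finset.sum_eq_zero fun j _ => ?_
  by_cases hj : j = 0
  · rw [hj, kSq_zero, zero_mul]
  · rw [etaConfig_apply_of_ne hj, Nat.cast_zero, mul_zero]

lemma diagEnergy_etaConfig (hjs : js ≠ 0) : diagEnergy N L φ js (etaConfig d N).1 = 0 := by
  rw [diagEnergy, restEnergy_etaConfig, etaConfig_apply_of_ne hjs,
    etaConfig_apply_of_ne (neg_ne_zero.mpr hjs)]
  simp

lemma PetaBar_apply (hjs : js ≠ 0) (hN : 2 ≤ N) (ψ : FockN d N) (c : Config d N) :
    PetaBar N js ψ c = if pairNum js c.1 = 0 ∧ c ≠ etaConfig d N then ψ c else 0 := by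
  rw [PetaBar, sub_apply, lp.coeFn_sub, Pi.sub_apply, Qgt_apply]
  have hcut : pairNum js c.1 + (N - 2) + 1 < N ↔ pairNum js c.1 = 0 := by omega
  simp only [hcut]
  by_cases hc : c = etaConfig d N
  · rw [hc, Peta_apply_self, if_pos (pairNum_etaConfig hjs), if_neg (by simp), sub_self]
  · simp only [Peta_apply_of_ne _ hc, sub_zero, ne_eq, hc, not_false_eq_true, and_true]

lemma inShell_div_two (hev : Even N) {c : Config d N} (hc : pairNum js c.1 = 0) :
    InShell N js (N / 2) c := by
  left
  rw [hc, zero_add, Nat.two_mul_div_two_of_even hev]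

lemma PivotsBounded.fFun_eq (h : PivotsBounded N L φ js z δ) (hjs : js ≠ 0) (hφ : φ ≠ 0)
    (hN : 2 ≤ N) (hev : Even N) : fFun N L φ js z = sectorPivot N L φ js z (etaConfig d N).1 := by
  have heven : N - 2 = 2 * (N / 2 - 1) := by
    obtain ⟨m, rfl⟩ := hev
    omega
  have ht : N / 2 - 1 < N / 2 := by omega
  obtain ⟨-, hRS⟩ := h.neumann hjs hφ ht (h.Gam_apply hjs hφ ht)
  have hcond : 2 ≤ (etaConfig d N).1 0 := by rwa [etaConfig_apply_zero]
  have hs : InShell N js (N / 2 - 1) (pairUp js (etaConfig d N)) := by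
    left
    rw [pairNum_pairUp hjs hcond, pairNum_etaConfig hjs]
    omega
  rw [fFun, heven, inner_eta, W_apply hjs, hRS, maskedInv, if_pos hs, Wst_apply hjs,
    pairDown_pairUp hjs hcond, eta_apply_self, sectorPivot_eq hjs hφ (etaConfig d N),
    diagEnergy_etaConfig hjs, gamEntry, pairUp_val hcond, hopDown_pairUpOcc hjs hcond]
  push_cast
  ring

lemma PivotsBounded.isTridiag_KNm2 (h : PivotsBounded N L φ js z δ) (hjs : js ≠ 0) (hφ : φ ≠ 0) :
    IsTridiag N L φ js z (N / 2) (flowDiag N L φ js z (N / 2)) (KNm2 N L φ js z) :=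
  h.isTridiag_flow hjs hφ le_rfl

lemma PivotsBounded.isReducedInverse_PetaBar (h : PivotsBounded N L φ js z δ) (hjs : js ≠ 0)
    (hφ : φ ≠ 0) (hN : 2 ≤ N) (hev : Even N) (hδ' : 0 < δ')
    (hpivot : ∀ c : Config d N, pairNum js c.1 = 0 → c ≠ etaConfig d N →
      δ' ≤ sectorPivot N L φ js z c.1) :
    ∃ B : FockN d N →L[ℂ] FockN d N,
      (∀ ψ c, ¬ (pairNum js c.1 = 0 ∧ c ≠ etaConfig d N) → B ψ c = 0) ∧
      IsReducedInverse (PetaBar N js) (KNm2 N L φ js z) B := by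
  obtain ⟨B, hB, hinv⟩ := h.isReducedInverse_of_isTridiag hjs hφ (h.isTridiag_KNm2 hjs hφ)
    (fun c hc => inShell_div_two hev hc.1) (PetaBar_apply hjs hN) hδ'
    (fun c hc => hpivot c hc.1 hc.2)
  refine ⟨B, fun ψ c hc => ?_, hinv⟩
  rw [hB, maskedInv, if_neg hc, zero_mul]

lemma PivotsBounded.Peta_mem_KNm2_domain (h : PivotsBounded N L φ js z δ) (hjs : js ≠ 0)
    (hφ : φ ≠ 0) (ψ : FockN d N) : Peta d N ψ ∈ (KNm2 N L φ js z).domain := by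
  refine ((h.isTridiag_KNm2 hjs hφ).mem_domain _).mpr (((lp.memℓp (Peta d N ψ)).const_smul
    ((diagEnergy N L φ js (etaConfig d N).1 - z : ℝ) : ℂ)).mono' fun c => ?_)
  split_ifs
  · by_cases hc : c = etaConfig d N
    · rw [hc, Pi.smul_apply, smul_eq_mul]
    · rw [Peta_apply_of_ne _ hc, mul_zero, norm_zero]
      exact norm_nonneg _
  · rw [norm_zero]
    exact norm_nonneg _

lemma PivotsBounded.KNm2_apply_etaConfig (h : PivotsBounded N L φ js z δ) (hjs : js ≠ 0)
    (hφ : φ ≠ 0) (hev : Even N) {ψ : FockN d N} (hψ : ψ ∈ (KNm2 N L φ js z).domain)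
    (hsupp : ∀ c, pairNum js c.1 ≠ 0 → ψ c = 0) :
    KNm2 N L φ js z ⟨ψ, hψ⟩ (etaConfig d N)
      = sectorPivot N L φ js z (etaConfig d N).1 * ψ (etaConfig d N) := by
  have hshell : InShell N js (N / 2) (etaConfig d N) := inShell_div_two hev (pairNum_etaConfig hjs)
  rw [(h.isTridiag_KNm2 hjs hφ).apply_of_inShell hjs le_rfl hψ
    (fun c hc => hsupp c fun hzero => hc (inShell_div_two hev hzero)) hshell, flowDiag,
    if_pos hshell]

lemma PivotsBounded.KN_eq (h : PivotsBounded N L φ js z δ) (hjs : js ≠ 0)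
    (hφ : φ ≠ 0) (hN : 2 ≤ N) (hev : Even N) (hδ' : 0 < δ')
    (hpivot : ∀ c : Config d N, pairNum js c.1 = 0 → c ≠ etaConfig d N →
      δ' ≤ sectorPivot N L φ js z c.1) :
    KN N L φ js z = LinearMap.toPMap
      ((fFun N L φ js z • Peta d N : FockN d N →L[ℂ] FockN d N) :
        FockN d N →ₗ[ℂ] FockN d N) ⊤ := by
  obtain ⟨B, hB, hinv⟩ := h.isReducedInverse_PetaBar hjs hφ hN hev hδ' hpivot
  refine LinearPMap.ext (Submodule.ext fun ψ => iff_of_true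
    (h.Peta_mem_KNm2_domain hjs hφ ψ) Submodule.mem_top) fun ψ hψ _ => ?_
  obtain ⟨χ, ξ, hξ, hχ, hξχ, hfesh⟩ := hinv.feshbach_apply (P := Peta d N) ⟨ψ, hψ⟩
  refine hfesh.trans (lp.ext (funext fun c => ?_))
  change (Peta d N χ - Peta d N (KNm2 N L φ js z ⟨ξ, hξ⟩)) c = fFun N L φ js z * Peta d N ψ c
  rw [lp.coeFn_sub, Pi.sub_apply]
  by_cases hc : c = etaConfig d N
  · have hχ_eta : χ (etaConfig d N)
        = sectorPivot N L φ js z (etaConfig d N).1 * Peta d N ψ (etaConfig d N) := by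
      rw [hχ]
      refine h.KNm2_apply_etaConfig hjs hφ hev _ fun c hc => Peta_apply_of_ne _ ?_
      rintro rfl
      exact hc (pairNum_etaConfig hjs)
    have hξ_supp (c : Config d N) (hc : ¬ (pairNum js c.1 = 0 ∧ c ≠ etaConfig d N)) : ξ c = 0 := by
      rw [hξχ, hB _ c hc]
    rw [hc, Peta_apply_self, Peta_apply_self, h.KNm2_apply_etaConfig hjs hφ hev hξ
      (fun c hc => hξ_supp c fun hS => hc hS.1), hξ_supp _ (fun hS => hS.2 rfl), mul_zero,
      sub_zero, hχ_eta, h.fFun_eq hjs hφ hN hev]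
  · rw [Peta_apply_of_ne _ hc, Peta_apply_of_ne _ hc, Peta_apply_of_ne _ hc, sub_zero, mul_zero]

end Eta

section Gap

variable {d : ℕ} {L : ℝ}

lemma le_kSq {j : Mode d} (hj : j ≠ 0) : (2 * Real.pi / L) ^ 2 ≤ kSq L j := by
  obtain ⟨i, hi⟩ : ∃ i, j i ≠ 0 := Function.ne_iff.mp hj
  have hone : (1 : ℝ) ≤ (j i : ℝ) ^ 2 := by
    exact_mod_cast Int.add_one_le_of_lt (sq_pos_of_ne_zero hi)
  calc (2 * Real.pi / L) ^ 2 ≤ (2 * Real.pi / L) ^ 2 * (j i : ℝ) ^ 2 :=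
        le_mul_of_one_le_right (sq_nonneg _) hone
    _ = (2 * Real.pi / L * (j i : ℝ)) ^ 2 := (mul_pow _ _ _).symm
    _ ≤ kSq L j := Finset.single_le_sum (f := fun i => (2 * Real.pi / L * (j i : ℝ)) ^ 2)
        (fun _ _ => sq_nonneg _) (Finset.mem_univ i)

lemma two_pi_div_sq_pos (hL : L ≠ 0) : 0 < (2 * Real.pi / L) ^ 2 := by
  have := Real.pi_pos
  positivity

lemma kSq_pos (hL : L ≠ 0) {j : Mode d} (hj : j ≠ 0) : 0 < kSq L j :=
  (two_pi_div_sq_pos hL).trans_le (le_kSq hj)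

lemma gap_le {j : Mode d} (hj : j ≠ 0) : gap d L ≤ kSq L j :=
  ciInf_le ⟨0, by rintro _ ⟨j, rfl⟩; exact kSq_nonneg _⟩ (⟨j, hj⟩ : {j : Mode d // j ≠ 0})

lemma gap_pos (hL : L ≠ 0) {j : Mode d} (hj : j ≠ 0) : 0 < gap d L :=
  have : Nonempty {j : Mode d // j ≠ 0} := ⟨⟨j, hj⟩⟩
  (two_pi_div_sq_pos hL).trans_le (le_ciInf fun j => le_kSq j.2)

lemma exists_ne_zero_of_ne_etaConfig {N : ℕ} {c : Config d N} (hc : c ≠ etaConfig d N) :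
    ∃ j, j ≠ 0 ∧ c.1 j ≠ 0 := by
  contrapose! hc
  have hsingle : c.1 = Finsupp.single 0 (c.1 0) := by
    ext j
    by_cases hj : j = 0
    · rw [hj, Finsupp.single_eq_same]
    · rw [hc j hj, Finsupp.single_eq_of_ne hj]
  have htotal := c.2
  rw [hsingle, Finsupp.sum_single_index rfl] at htotal
  rw [htotal] at hsingle
  exact Subtype.ext hsingle

lemma gap_le_restEnergy {N : ℕ} {js : Mode d} {c : Config d N} (hzero : pairNum js c.1 = 0)
    (hc : c ≠ etaConfig d N) : gap d L ≤ restEnergy L js c.1 := by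
  obtain ⟨j, hj, hjc⟩ := exists_ne_zero_of_ne_etaConfig hc
  rw [pairNum, Nat.add_eq_zero_iff] at hzero
  have hj_pos : j ≠ js := fun hjs => hjc (hjs ▸ hzero.1)
  have hj_neg : j ≠ -js := fun hjs => hjc (hjs ▸ hzero.2)
  have hone : (1 : ℝ) ≤ c.1 j := by exact_mod_cast Nat.one_le_iff_ne_zero.mpr hjc
  calc gap d L ≤ kSq L j := gap_le hj
    _ ≤ kSq L j * c.1 j := le_mul_of_one_le_right (kSq_nonneg j) hone
    _ ≤ restEnergy L js c.1 := Finset.single_le_sum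
        (f := fun j => kSq L j * (c.1 j : ℝ))
        (fun j _ => mul_nonneg (kSq_nonneg j) (Nat.cast_nonneg _))
        (Finset.mem_filter.mpr ⟨Finsupp.mem_support_iff.mpr hjc, hj_pos, hj_neg⟩)

end Gap

section Threshold

variable {d N : ℕ} {L φ z e s x v : ℝ} {js : Mode d}

lemma bogParam_sqrt {ε : ℝ} (hpos : 0 < ε) (hle : ε ≤ 1 / 100) :
    BogParam (√ε) (√(ε ^ 2 + 2 * ε)) (1 + ε - √(ε ^ 2 + 2 * ε)) where
  e_pos := Real.sqrt_pos.mpr hpos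
  e_le := Real.sqrt_le_iff.mpr ⟨by norm_num, by norm_num; linarith⟩
  s_pos := Real.sqrt_pos.mpr (by positivity)
  s_sq := by
    rw [Real.sq_sqrt (by positivity), show √ε ^ 4 = (√ε ^ 2) ^ 2 by ring, Real.sq_sqrt hpos.le]
  x_eq := by rw [Real.sq_sqrt hpos.le]

lemma zMax_eq (hφ : 0 < φ) : zMax L φ js =
    -(φ * ((1 + eps L φ js - √(eps L φ js ^ 2 + 2 * eps L φ js))
      - √(eps L φ js) * √(eps L φ js ^ 2 + 2 * eps L φ js))) := by
  have hkSq : kSq L js = φ * eps L φ js := by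
    rw [eps, mul_div_cancel₀ _ hφ.ne']
  have hsqrt : √(kSq L js ^ 2 + 2 * φ * kSq L js)
      = φ * √(eps L φ js ^ 2 + 2 * eps L φ js) := by
    rw [hkSq, show (φ * eps L φ js) ^ 2 + 2 * φ * (φ * eps L φ js)
      = φ ^ 2 * (eps L φ js ^ 2 + 2 * eps L φ js) by ring, Real.sqrt_mul (by positivity),
      Real.sqrt_sq hφ.le]
  rw [zMax, eBog, hsqrt, hkSq]
  ring

lemma le_restEnergy_sub_div {y : ℝ} (hz : z ≤ -(φ * y)) (hφ : 0 < φ) (n : Occ d) :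
    y ≤ (restEnergy L js n - z) / φ := by
  rw [le_div_iff₀ hφ]
  linarith [restEnergy_nonneg (L := L) (js := js) n]

lemma BogParam.pivotsBounded (h : BogParam e s x) (he : eps L φ js = e ^ 2)
    (hz : z ≤ -(φ * (x - e * s))) (hjs : js ≠ 0) (hφ : 0 < φ) (hN : 0 < N) :
    PivotsBounded N L φ js z (φ * (1 / N * (2 / 5))) := by
  refine ⟨by positivity, fun c hc => ?_⟩
  have hocc : (c.1 0 : ℝ) + c.1 js + c.1 (-js) ≤ N := by
    have := occ_add_pairNum_le hjs c
    rw [← add_assoc] at this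
    exact_mod_cast this
  have hv := le_restEnergy_sub_div (L := L) (js := js) hz hφ c.1
  rw [sectorPivot, he]
  refine mul_le_mul_of_nonneg_left ?_ hφ.le
  linarith [h.inv_add_sub_threshold_le_pivot (Nat.cast_pos.mpr hN) hv hc hocc]

lemma sectorPivot_etaConfig (hjs : js ≠ 0) : sectorPivot N L φ js z (etaConfig d N).1
    = φ * pivot N (eps L φ js) (-z / φ) N 0 0 := by
  rw [sectorPivot, restEnergy_etaConfig, etaConfig_apply_zero, etaConfig_apply_of_ne hjs,
    etaConfig_apply_of_ne (neg_ne_zero.mpr hjs), zero_sub]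

lemma BogParam.fFun_eq_zero_iff (h : BogParam e s x) (he : eps L φ js = e ^ 2)
    (hjs : js ≠ 0) (hφ : 0 < φ) (hN : 2 ≤ N) (hev : Even N) (hv : x - e * s ≤ v)
    (hroot : pivot N (e ^ 2) v N 0 0 = 0) (hz : z ≤ -(φ * (x - e * s))) :
    fFun N L φ js z = 0 ↔ z = -(φ * v) := by
  have hN0 : 0 < N := two_pos.trans_le hN
  have hz_mem : -z / φ ∈ Set.Ici (x - e * s) := by
    rw [Set.mem_Ici, le_div_iff₀ hφ]
    linarith
  have hinj := (h.pivot_strictMonoOn (N := N) (n := N) (a := 0) (b := 0)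
    (Nat.cast_pos.mpr hN0) (by simp)).injOn.eq_iff hz_mem (Set.mem_Ici.mpr hv)
  rw [(h.pivotsBounded he hz hjs hφ hN0).fFun_eq hjs hφ.ne' hN hev, Complex.ofReal_eq_zero,
    sectorPivot_etaConfig hjs, he, mul_eq_zero, or_iff_right hφ.ne', ← hroot, hinj,
    div_eq_iff hφ.ne', neg_eq_iff_eq_neg, mul_comm]

lemma BogParam.half_gap_le_sectorPivot (h : BogParam e s x) (he : eps L φ js = e ^ 2)
    (hφ : 0 < φ) (hN : 5 ≤ N * e) (hv : x - e * s ≤ v) (hroot : pivot N (e ^ 2) v N 0 0 = 0)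
    (hgap : 0 ≤ gap d L) (hz : z ≤ -(φ * v) + gap d L / 2) {c : Config d N}
    (hzero : pairNum js c.1 = 0) (hc : c ≠ etaConfig d N) :
    gap d L / 2 ≤ sectorPivot N L φ js z c.1 := by
  have hrest := gap_le_restEnergy (L := L) hzero hc
  have hle : v ≤ (restEnergy L js c.1 - z) / φ := by
    rw [le_div_iff₀ hφ]
    linarith
  rw [pairNum, Nat.add_eq_zero_iff] at hzero
  rw [sectorPivot, he, hzero.1, hzero.2]
  calc gap d L / 2 ≤ φ * ((restEnergy L js c.1 - z) / φ - v) := by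
        rw [mul_sub, mul_div_cancel₀ _ hφ.ne']
        linarith
    _ ≤ _ := mul_le_mul_of_nonneg_left
        (h.sub_le_pivot_of_root hN hv hroot hle (le_of_config c 0)) hφ.le

lemma hundred_le_mul_sqrt_pow {N ε : ℝ} (hN : 0 < N) (hε : 0 ≤ ε)
    (h : 1 / N ≤ 1 / 100 * ε * √ε) : 100 ≤ N * √ε ^ 3 := by
  have hcube : ε * √ε = √ε ^ 3 := by
    rw [pow_succ, Real.sq_sqrt hε]
  rw [mul_assoc, hcube, div_le_iff₀ hN] at h
  linarith

lemma BogParam.five_le_mul (h : BogParam e s x) {N : ℝ} (hN : 100 ≤ N * e ^ 3) : 5 ≤ N * e := by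
  have he := h.e_pos
  have he_sq : e ^ 2 ≤ 1 := pow_le_one₀ he.le (h.e_le.trans (by norm_num))
  have hNe : 0 < N * e := by
    by_contra! hneg
    nlinarith [sq_nonneg e]
  nlinarith [mul_le_of_le_one_right hNe.le he_sq]

end Threshold

end BogThreeModes

end

theorem mainTheorem7_general {d N : ℕ} {L φ : ℝ} {js : Mode d} (hN : 0 < N) (hev : Even N)
    (hL : 0 < L) (hφ : 0 < φ) (hjs : js ≠ 0) (hε : eps L φ js ≤ 1 / 100)
    (hNε : 1 / (N : ℝ) ≤ 1 / 100 * eps L φ js * √(eps L φ js)) :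
    (∀ z : ℝ, z ≤ zMax L φ js → FlowWellDefined N L φ js z) ∧
    ∃ zs : ℝ,
      (zs ≤ zMax L φ js ∧ fFun N L φ js zs = 0 ∧
        ∀ z : ℝ, z ≤ zMax L φ js → fFun N L φ js z = 0 → z = zs) ∧
      zs < min (zs + gap d L / 2) (zMax L φ js) ∧
      ∀ z : ℝ, z < min (zs + gap d L / 2) (zMax L φ js) →
        BoundedInvertibleOn (PetaBar N js) (KNm2 N L φ js z) ∧
        KN N L φ js z = LinearMap.toPMap
          ((fFun N L φ js z • Peta d N : FockN d N →L[ℂ] FockN d N) :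
            FockN d N →ₗ[ℂ] FockN d N) ⊤ := by
  have hε0 : 0 < eps L φ js := div_pos (kSq_pos hL.ne' hjs) hφ
  have he : eps L φ js = √(eps L φ js) ^ 2 := (Real.sq_sqrt hε0.le).symm
  have hp := bogParam_sqrt hε0 hε
  have hN2 : 2 ≤ N := by grind
  have hNe3 := hundred_le_mul_sqrt_pow (Nat.cast_pos.mpr hN) hε0.le hNε
  obtain ⟨v, hv, hroot⟩ := hp.exists_pivot_eq_zero hNe3
  have hpivots {z : ℝ} (hz : z ≤ zMax L φ js) :=
    hp.pivotsBounded he (hz.trans_eq (zMax_eq hφ)) hjs hφ hN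
  have hzero {z : ℝ} (hz : z ≤ zMax L φ js) : fFun N L φ js z = 0 ↔ z = -(φ * v) :=
    hp.fFun_eq_zero_iff he hjs hφ hN2 hev hv.le hroot (hz.trans_eq (zMax_eq hφ))
  have hzs : -(φ * v) < zMax L φ js := by
    rw [zMax_eq hφ]
    exact neg_lt_neg (mul_lt_mul_of_pos_left hv hφ)
  have hgap : 0 < gap d L := gap_pos hL.ne' hjs
  refine ⟨fun z hz => (hpivots hz).flowWellDefined hjs hφ.ne', -(φ * v),
    ⟨hzs.le, (hzero hzs.le).mpr rfl, fun z hz => (hzero hz).mp⟩,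
    lt_min (lt_add_of_pos_right _ (half_pos hgap)) hzs, fun z hz => ?_⟩
  obtain ⟨hz_gap, hz_max⟩ := lt_min_iff.mp hz
  have hlow (c : Config d N) := hp.half_gap_le_sectorPivot (z := z) (c := c) he hφ
    (hp.five_le_mul hNe3) hv.le hroot hgap.le hz_gap.le
  obtain ⟨B, -, hB⟩ := (hpivots hz_max.le).isReducedInverse_PetaBar hjs hφ.ne' hN2 hev
    (half_pos hgap) hlow
  exact ⟨⟨B, hB⟩, (hpivots hz_max.le).KN_eq hjs hφ.ne' hN2 hev (half_pos hgap) hlow⟩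

theorem mainTheorem7 :
    ∀ γ : ℝ, 0 < γ → γ < 1 → ∃ kγ : ℝ, 0 < kγ ∧
    ∀ μ θ C : ℝ, 0 < μ → μ < 1 → 0 < θ → 0 < C → ∃ ε₀ : ℝ, 0 < ε₀ ∧
    ∀ (d N : ℕ) (L φ : ℝ) (js : Mode d),
      1 ≤ d → 0 < N → Even N → 0 < L → 0 < φ → js ≠ 0 →
      eps L φ js ≤ ε₀ →
      (eps L φ js) ^ 2 + eps L φ js / (N : ℝ) ^ γ + 1 / (N : ℝ)
        ≤ kγ * eps L φ js * Real.sqrt (eps L φ js) →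
      1 / (N : ℝ) ^ (1 - γ) ≤ kγ * eps L φ js →
      φ / gap d L * ((N : ℝ) ^ μ / ((N : ℝ) * ((N : ℝ) - (N : ℝ) ^ μ))) < 1 / 2 →
      1 / (N : ℝ) ^ μ ≤ C * Real.sqrt (eps L φ js) ^ (1 + θ) →
      (∀ z : ℝ, z ≤ zMax L φ js → FlowWellDefined N L φ js z) ∧
      ∃ zs : ℝ,
        (zs ≤ zMax L φ js ∧ fFun N L φ js zs = 0 ∧
          ∀ z : ℝ, z ≤ zMax L φ js → fFun N L φ js z = 0 → z = zs) ∧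
        zs < min (zs + gap d L / 2) (zMax L φ js) ∧
        ∀ z : ℝ, z < min (zs + gap d L / 2) (zMax L φ js) →
          BoundedInvertibleOn (PetaBar N js) (KNm2 N L φ js z) ∧
          KN N L φ js z = LinearMap.toPMap
            ((fFun N L φ js z • Peta d N : FockN d N →L[ℂ] FockN d N) :
              FockN d N →ₗ[ℂ] FockN d N) ⊤ := by
  intro γ _ _
  refine ⟨1 / 100, by norm_num, fun μ θ C _ _ _ _ => ⟨1 / 100, by norm_num, ?_⟩⟩
  intro d N L φ js _ hN hev hL hφ hjs hε hcond _ _ _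
  have hε0 : 0 ≤ eps L φ js := div_nonneg (kSq_nonneg js) hφ.le
  have hnonneg : 0 ≤ (eps L φ js) ^ 2 + eps L φ js / (N : ℝ) ^ γ := by positivity
  exact mainTheorem7_general hN hev hL hφ hjs hε (by linarith)
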